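/- **Setting.** Let $G$ be a finite-dimensional real Lie group with identity $e$ and Lie algebra $\mathfrak g$, let $\mathbb I$ be an inner product on $\mathfrak g$ (the kinetic energy tensor) with $\mathbb I^\flat:\mathfrak g\to\mathfrak g^*$ and $\mathbb I^\sharp=(\mathbb I^\flat)^{-1}$, and write $\mathscr L_g$ for left translation by $g$. Let $\Psi_G:G\to\mathbb R_{\ge 0}$ be smooth and proper with $\Psi_G(e)=0$, $\mathrm d\Psi_G(e)=0$ and $\operatorname{Hess}\Psi_G(e)$ positive definite; put $\Psi_{G,r}(g_1,g_2)=\Psi_G(g_2^{-1}g_1)$, and let $$\tau_L=\sup\{L : e\in\Psi_G^{-1}(\le L),\ \mathrm d\Psi_G(g)\neq 0 \text{ for all } g\in\Psi_G^{-1}(\le L)\setminus\{e\}\}\in[-\infty,\infty].$$ Let $R_{\rm diss}$ be a bilinear form on $\mathfrak g$ with $R_{\rm diss}(v,v)\ge 0$ for all $v$, and let $R^\flat_{\rm diss}(v)=R_{\rm diss}(v,\cdot)$, $K_p>0$ and $\alpha_i>0$. There are $n$ agents and a reference, which form the vertices of a directed graph; $\tilde a_{ij}=1$ if there is an edge from $j$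 to $i$, and $\tilde a_{ij}=0$ otherwise, and $\delta_i^{\rm in}$ is the in-degree of $i$. The graph is an out-tree whose root is the reference: every agent can be reached from the root along directed edges, no edge enters the root, and every agent has in-degree at most $1$. The reference $\gamma_r:[0,\infty)\to G$ is twice differentiable, and its body velocity $v_r$ is bounded. The agents obey $$\gamma_i'=\mathrm T_e\mathscr L_{\gamma_i}(v_i),\qquad v_i'-\mathbb I^\sharp(\operatorname{ad}^*_{v_i}\mathbb I^\flat(v_i))=\mathbb I^\sharp(u_i).$$ With sums over all agents and the reference, let $$F_i=\sum_j\tilde a_{ij}(\mathrm T_e\mathscr L_{\gamma_i})^*(\mathrm d_i\Psi_{G,r}(\gamma_i,\gamma_j)),\qquad \sigma_i=\sum_j\tilde a_{ij}\bigl(v_i-\operatorname{Ad}_{\gamma_i^{-1}\gamma_j}v_j\bigr)+K_p\,\mathbb I^\sharp F_i,$$ where $\mathrm d_i\Psi_{G,r}(\gamma_i,\gamma_j)$ is the differential in the first argument. The controller is $$\begin{aligned}u_i=\frac1{\delta_i^{\rm in}}\Bigl(&-\frac1{\alpha_i}\Bigl[K_p\sum_j\tilde a_{ij}(\mathrm T_e\mathscr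 L_{\gamma_j^{-1}\gamma_i})^*\bigl(\mathrm d\Psi_G(\gamma_j^{-1}\gamma_i)\bigr)+R^\flat_{\rm diss}(\sigma_i)\Bigr]\\&+\sum_j\tilde a_{ij}\,\mathbb I^\flat\bigl([\operatorname{Ad}_{\gamma_i^{-1}\gamma_j}v_j,\,v_i]+\operatorname{Ad}_{\gamma_i^{-1}\gamma_j}v_j'\bigr)-\operatorname{ad}^*_{v_i}\mathbb I^\flat(v_i)-K_p\,\mathbb I^\flat\frac{\mathrm d}{\mathrm dt}\bigl(\mathbb I^\sharp F_i\bigr)\Bigr).\end{aligned}$$ Let $\mathcal S^3$ be the set of initial states of the agents such that, at $t=0$, $$K_p\tilde a_{ij}\Psi_{G,r}(\gamma_i,\gamma_j)+\tfrac12\alpha_i\,\mathbb I(\sigma_i,\sigma_i)<K_p\tau_L\quad\text{for every agent } i \text{ and every in-neighbour } j \text{ of } i.$$ **Theorem.** (1) From every initial state in $\mathcal S^3$ the closed loop has a trajectory on $[0,\infty)$, and along every such trajectory all agents converge to the reference: $\gamma_r(t)^{-1}\gamma_i(t)\to e$ and $v_i(t)-v_r(t)\to 0$ as $t\to\infty$,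 for all $i$. (2) The tracking equilibrium $\gamma_1=\dots=\gamma_n=\gamma_r$, $v_1=\dots=v_n=v_r$ is locally asymptotically stable: for all neighbourhoods $U$ of $e$ in $G$ and $W$ of $0$ in $\mathfrak g$ there are neighbourhoods $U_0$ of $e$ and $W_0$ of $0$ such that every trajectory on $[0,\infty)$ with $\gamma_r(0)^{-1}\gamma_i(0)\in U_0$ and $v_i(0)-v_r(0)\in W_0$ for all $i$ satisfies $\gamma_r(t)^{-1}\gamma_i(t)\in U$ and $v_i(t)-v_r(t)\in W$ for all $i$ and all $t\ge 0$; moreover there are neighbourhoods $U_1$ of $e$ and $W_1$ of $0$ such that from every initial state with $\gamma_r(0)^{-1}\gamma_i(0)\in U_1$, $v_i(0)-v_r(0)\in W_1$ for all $i$ there is a trajectory on $[0,\infty)$, and every such trajectory converges to the reference as in (1). -/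

import Mathlib

open Set Filter Topology
open scoped Manifold ContDiff

noncomputable section

namespace LieConsensus

/-! ### Differential geometry of the Lie group -/

section Group

variable (E : Type*) [NormedAddCommGroup E] [NormedSpace ℝ E]
variable (G : Type*) [TopologicalSpace G] [ChartedSpace E G] [Group G]

/-- The Lie algebra `𝔤 = T_e G`, with Mathlib's bracket (that of left-invariant vector fields). -/
abbrev Alg : Type _ := GroupLieAlgebra 𝓘(ℝ, E) G

instance minSmoothness_three_leInfty : ENat.LEInfty (minSmoothness ℝ 3) where
  out := by
    rw [minSmoothness_of_isRCLikeNormedField]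
    exact ENat.LEInfty.out

variable {E G}

/-- `T_e L_g : 𝔤 → T_g G`, the tangent map of the left translation `L_g`. -/
def tangentLeft (g : G) : Alg E G →L[ℝ] TangentSpace 𝓘(ℝ, E) g :=
  mfderiv 𝓘(ℝ, E) 𝓘(ℝ, E) (fun x : G => g * x) 1

/-- `Ad_g : 𝔤 → 𝔤`, the tangent map at `e` of the conjugation `x ↦ g x g⁻¹`. -/
def Ad (g : G) : Alg E G →L[ℝ] Alg E G :=
  mfderiv 𝓘(ℝ, E) 𝓘(ℝ, E) (fun x : G => g * x * g⁻¹) 1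

/-- The differential `dΨ(g) ∈ T_g^* G` of a real function on `G`. -/
def differential (Ψ : G → ℝ) (g : G) : TangentSpace 𝓘(ℝ, E) g →L[ℝ] ℝ :=
  mfderiv 𝓘(ℝ, E) 𝓘(ℝ, ℝ) Ψ g

/-- `(T_e L_g)^* : T_g^* G → 𝔤^*`. -/
def pullLeft (g : G) (φ : TangentSpace 𝓘(ℝ, E) g →L[ℝ] ℝ) : Module.Dual ℝ (Alg E G) :=
  (φ ∘L tangentLeft g).toLinearMap

/-- `ad^*_v : 𝔤^* → 𝔤^*`, `⟨ad^*_v φ; w⟩ = ⟨φ; [v, w]⟩`. -/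
def adStar [CompleteSpace E] [LieGroup 𝓘(ℝ, E) ∞ G] (v : Alg E G)
    (φ : Module.Dual ℝ (Alg E G)) : Module.Dual ℝ (Alg E G) :=
  φ ∘ₗ (LieAlgebra.ad ℝ (Alg E G) v)

/-- `γ' (t) = T_e L_{γ(t)} (v t)` for all `t ≥ 0` (one-sided at `t = 0`): the curve `γ` is
differentiable on `[0, ∞)` with body velocity `v`. -/
def HasBodyVelocity (γ : ℝ → G) (v : ℝ → Alg E G) : Prop :=
  ∀ t, 0 ≤ t → HasMFDerivWithinAt 𝓘(ℝ, ℝ) 𝓘(ℝ, E) γ (Ici 0) t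
    (ContinuousLinearMap.toSpanSingleton ℝ (tangentLeft (γ t) (v t)))

/-- The Hessian at `e` in the preferred chart around `e`, as a quadratic form on `T_e G`
(independent of the chart when `e` is a critical point). -/
def hessianAtOne (Ψ : G → ℝ) (v : Alg E G) : ℝ :=
  let f : E → ℝ := fun x => Ψ ((extChartAt 𝓘(ℝ, E) (1 : G)).symm x)
  fderiv ℝ (fderiv ℝ f) (extChartAt 𝓘(ℝ, E) (1 : G) 1) v v

variable (E) in
/-- The functions `Ψ_G : G → ℝ_{≥0}` from which tracking error functions are built. -/
structure IsErrorFunction (Ψ : G → ℝ) : Prop where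
  smooth : ContMDiff 𝓘(ℝ, E) 𝓘(ℝ, ℝ) ∞ Ψ
  nonneg : ∀ g, 0 ≤ Ψ g
  proper : IsProperMap Ψ
  map_one : Ψ 1 = 0
  critical_one : differential (E := E) Ψ 1 = 0
  hessian_pos : ∀ v : Alg E G, v ≠ 0 → 0 < hessianAtOne Ψ v

/-- The right tracking error function `Ψ_{G,r}(g₁, g₂) = Ψ_G(g₂⁻¹ g₁)`. -/
def trackingError (Ψ : G → ℝ) (g₁ g₂ : G) : ℝ := Ψ (g₂⁻¹ * g₁)

variable (E) in
/-- `τ_L`: the supremum of the levels `L` whose sublevel set contains `e` and no critical point of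
`Ψ_G` other than `e`. It may be `+∞`; it is `-∞` if there is no such level. -/
def criticalLevel (Ψ : G → ℝ) : EReal :=
  sSup {x : EReal | ∃ L : ℝ, x = (L : EReal) ∧ (1 : G) ∈ {g | Ψ g ≤ L} ∧
    ∀ g ∈ {g | Ψ g ≤ L} \ {1}, differential (E := E) Ψ g ≠ 0}

variable (E G) in
/-- A kinetic energy tensor: an inner product on `𝔤`. -/
structure Inertia where
  form : LinearMap.BilinForm ℝ (Alg E G)
  symm : ∀ v w, form v w = form w v
  pos : ∀ v, v ≠ 0 → 0 < form v v

namespace Inertia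

variable (J : Inertia E G)

/-- `𝕀^♭ : 𝔤 → 𝔤^*`. -/
def flat : Alg E G →ₗ[ℝ] Module.Dual ℝ (Alg E G) := J.form

theorem flat_injective : Function.Injective J.flat := by
  rw [injective_iff_map_eq_zero]
  intro v hv
  by_contra h
  have h1 := J.pos v h
  have h2 : J.form v v = 0 := by
    have := congrArg (fun f : Module.Dual ℝ (Alg E G) => f v) hv
    simpa [flat] using this
  exact h1.ne' h2

variable [FiniteDimensional ℝ E]

instance : FiniteDimensional ℝ (Alg E G) := inferInstanceAs (FiniteDimensional ℝ E)

/-- `𝕀^♭` as a linear isomorphism. -/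
def flatEquiv : Alg E G ≃ₗ[ℝ] Module.Dual ℝ (Alg E G) :=
  LinearEquiv.ofInjectiveOfFinrankEq J.flat J.flat_injective Subspace.dual_finrank_eq.symm

/-- `𝕀^♯ : 𝔤^* → 𝔤`, the inverse of `𝕀^♭`. -/
def sharp : Module.Dual ℝ (Alg E G) →ₗ[ℝ] Alg E G := J.flatEquiv.symm.toLinearMap

end Inertia

end Group

/-! ### Communication graphs

The vertices are `Option ι`: the vertex `some i` is the agent `i`, and `none` is the reference.
An edge from `j` to `i` (`𝒢.Adj j i`) means that `i` receives information from `j`. -/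

section Graph

open Classical in
/-- The entry `ã_{ij}` of the adjacency matrix: `1` if `j` is an in-neighbour of `i`, else `0`. -/
def adjCoeff {V : Type*} (𝒢 : Digraph V) (i j : V) : ℝ := if 𝒢.Adj j i then 1 else 0

/-- The in-degree of a vertex. -/
def inDegree {V : Type*} (𝒢 : Digraph V) (i : V) : ℕ := {j | 𝒢.Adj j i}.ncard

/-- A directed out-tree with root `r`: every vertex is reachable from `r` along directed edges, no
edge enters `r`, and every other vertex has in-degree at most one. -/
structure IsOutTree {V : Type*} (𝒢 : Digraph V) (r : V) : Prop where
  reachable : ∀ i, Relation.ReflTransGen 𝒢.Adj r i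
  root : ∀ j, ¬ 𝒢.Adj j r
  inDegree_le_one : ∀ i, i ≠ r → inDegree 𝒢 i ≤ 1

end Graph

/-! ### The controlled network -/

section Network

variable (E : Type*) [NormedAddCommGroup E] [NormedSpace ℝ E]
variable (G : Type*) [TopologicalSpace G] [ChartedSpace E G] [Group G]
variable (ι : Type*)

/-- The data of the network and of the controller. -/
structure Network where
  /-- the communication graph on the agents and the reference -/
  graph : Digraph (Option ι)
  /-- the kinetic energy tensor `𝕀` common to the agents -/
  inertia : Inertia E G
  /-- the function `Ψ_G` -/
  Ψ : G → ℝ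
  /-- the dissipation form `R_diss` -/
  Rdiss : LinearMap.BilinForm ℝ (Alg E G)
  /-- the gain `K_p` -/
  Kp : ℝ
  /-- the gains `α_i` -/
  α : ι → ℝ

variable {E G ι}

/-- The standing assumptions on the data. -/
structure Network.Admissible (N : Network E G ι) : Prop where
  errorFunction : IsErrorFunction E N.Ψ
  dissipation : ∀ v, 0 ≤ N.Rdiss v v
  Kp_pos : 0 < N.Kp
  α_pos : ∀ i, 0 < N.α i

/-- The reference together with the agents. -/
def withRef {X : Type*} (r : X) (x : ι → X) : Option ι → X := fun j => j.elim r x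

namespace Network

variable [Fintype ι] [FiniteDimensional ℝ E]
variable (N : Network E G ι)

/-- `∑_j ã_{ij} (T_e L_{g_i})^* (d_i Ψ_{G,r}(g_i, g_j))`. -/
def positionError (g : Option ι → G) (i : ι) : Module.Dual ℝ (Alg E G) :=
  ∑ j : Option ι, adjCoeff N.graph (some i) j •
    pullLeft (g (some i)) (differential (fun x => trackingError N.Ψ x (g j)) (g (some i)))

/-- `v^e_i = ∑_j ã_{ij} (v_i - Ad_{g_i⁻¹ g_j} v_j)`. -/
def velocityError (g : Option ι → G) (w : Option ι → Alg E G) (i : ι) : Alg E G :=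
  ∑ j : Option ι, adjCoeff N.graph (some i) j •
    (w (some i) - Ad ((g (some i))⁻¹ * g j) (w j))

/-- `σ_i = v^e_i + K_p 𝕀^♯ ∑_j ã_{ij} (T_e L_{g_i})^* (d_i Ψ_{G,r}(g_i, g_j))`. -/
def sigma (g : Option ι → G) (w : Option ι → Alg E G) (i : ι) : Alg E G :=
  N.velocityError g w i + N.Kp • N.inertia.sharp (N.positionError g i)

variable (E) in
/-- The set `𝒮³` of initial states. -/
def initialSet : Set ((Option ι → G) × (Option ι → Alg E G)) :=
  {x | ∀ (i : ι) (j : Option ι), N.graph.Adj j (some i) →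
    ((N.Kp * adjCoeff N.graph (some i) j * trackingError N.Ψ (x.1 (some i)) (x.1 j)
      + (1 / 2) * N.α i * N.inertia.form (N.sigma x.1 x.2 i) (N.sigma x.1 x.2 i) : ℝ) : EReal)
      < (N.Kp : EReal) * criticalLevel E N.Ψ}

variable [LieGroup 𝓘(ℝ, E) ∞ G]

/-- The feedback `u_i(t)`, evaluated along configurations `γ` and body velocities `v` of the
reference and of the agents. -/
def control [CompleteSpace E] (γ : Option ι → ℝ → G) (v : Option ι → ℝ → Alg E G)
    (i : ι) (t : ℝ) : Module.Dual ℝ (Alg E G) :=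
  let g : Option ι → G := fun j => γ j t
  let w : Option ι → Alg E G := fun j => v j t
  let wi : Alg E G := w (some i)
  let J := N.inertia
  (1 / (inDegree N.graph (some i) : ℝ)) •
    (-((1 / N.α i) •
        (N.Kp • ∑ j : Option ι, adjCoeff N.graph (some i) j •
            pullLeft ((g j)⁻¹ * g (some i)) (differential N.Ψ ((g j)⁻¹ * g (some i)))
          + N.Rdiss (N.sigma g w i)))
      + ∑ j : Option ι, adjCoeff N.graph (some i) j •
          J.flat (⁅Ad ((g (some i))⁻¹ * g j) (w j), wi⁆
            + Ad ((g (some i))⁻¹ * g j) (derivWithin (v j) (Ici 0) t))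
      - adStar wi (J.flat wi)
      - N.Kp • J.flat
          (derivWithin (fun s => J.sharp (N.positionError (fun j => γ j s) i)) (Ici 0) t))

/-- `(γ_i, v_i)_i` is a trajectory on `[0, ∞)` of the agents in closed loop with the feedback, when
the reference moves along `γr` with body velocity `vr`:
`γ_i' = T_e L_{γ_i} v_i` and `v_i' - 𝕀^♯ (ad^*_{v_i} 𝕀^♭ v_i) = 𝕀^♯ u_i`. -/
structure IsTrajectory [CompleteSpace E] (γr : ℝ → G) (vr : ℝ → Alg E G)
    (γ : ι → ℝ → G) (v : ι → ℝ → Alg E G) : Prop where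
  kinematics : ∀ i, HasBodyVelocity (γ i) (v i)
  dynamics : ∀ i t, 0 ≤ t → HasDerivWithinAt (v i)
    (N.inertia.sharp (adStar (v i t) (N.inertia.flat (v i t)))
      + N.inertia.sharp (N.control (withRef γr γ) (withRef vr v) i t)) (Ici 0) t

/-- All agents converge to the reference, in configuration and in body velocity. -/
def Tracks (γr : ℝ → G) (vr : ℝ → Alg E G) (γ : ι → ℝ → G) (v : ι → ℝ → Alg E G) : Prop :=
  ∀ i, Tendsto (fun t => (γr t)⁻¹ * γ i t) atTop (𝓝 1) ∧
    Tendsto (fun t => v i t - vr t) atTop (𝓝 0)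

/-- The agents' states `(g, w)` are within `U`, `W` of the reference state `(gr, wr)`. -/
def Near (U : Set G) (W : Set (Alg E G)) (gr : G) (wr : Alg E G)
    (g : ι → G) (w : ι → Alg E G) : Prop :=
  ∀ i, gr⁻¹ * g i ∈ U ∧ w i - wr ∈ W

/-- Local asymptotic stability of `g_1 = ⋯ = g_n = γ_r`, `v_1 = ⋯ = v_n = v_r`: the closed loop can
be run for all times from every nearby initial state, the equilibrium is stable, and every
trajectory that starts nearby converges to it. -/
structure TrackingIsLAS [CompleteSpace E] (γr : ℝ → G) (vr : ℝ → Alg E G) : Prop where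
  stable : ∀ U ∈ 𝓝 (1 : G), ∀ W ∈ 𝓝 (0 : Alg E G),
    ∃ U₀ ∈ 𝓝 (1 : G), ∃ W₀ ∈ 𝓝 (0 : Alg E G), ∀ γ v, N.IsTrajectory γr vr γ v →
      Near U₀ W₀ (γr 0) (vr 0) (fun i => γ i 0) (fun i => v i 0) →
      ∀ t, 0 ≤ t → Near U W (γr t) (vr t) (fun i => γ i t) (fun i => v i t)
  attractive : ∃ U₁ ∈ 𝓝 (1 : G), ∃ W₁ ∈ 𝓝 (0 : Alg E G),
    (∀ g w, Near U₁ W₁ (γr 0) (vr 0) g w →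
      ∃ γ v, N.IsTrajectory γr vr γ v ∧ (∀ i, γ i 0 = g i) ∧ (∀ i, v i 0 = w i)) ∧
    ∀ γ v, N.IsTrajectory γr vr γ v →
      Near U₁ W₁ (γr 0) (vr 0) (fun i => γ i 0) (fun i => v i 0) → Tracks γr vr γ v

end Network

end Network

end LieConsensus

end

/-! In an out-tree every agent has exactly one in-neighbour, its parent p, so each sum over
in-neighbours has a single term. Put h = γ_p⁻¹ γ_i, let X be the gradient of Ψ_G with respect to 𝕀,
and σ = v_i - Ad_{h⁻¹} v_p + K_p X(h). The controller cancels the Coriolis term and supplies the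
derivatives of Ad_{h⁻¹} v_p and of K_p X(h), so the closed loop is equivalent to one autonomous
system per edge, h' = T_e L_h (σ - K_p X(h)), α σ' = -K_p X(h) - 𝕀^♯ R_diss(σ) (`acceleration_eq`,
`ErrorSystem.hasDerivWithinAt_iff_solvesWithinAt`).

The energy V = K_p Ψ_G(h) + α/2 𝕀(σ, σ) satisfies V' = -K_p² 𝕀(X, X) - R_diss(σ, σ) ≤ 0. Its
sublevel sets are compact because Ψ_G is proper, so solutions exist for all times. Since R_diss may
be degenerate, V' controls only X(h). Barbalat's lemma gives X(h) → 0, hence h → e once h stays in a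
compact set where e is the only critical point. A second application gives (X(h))' → 0;
nondegeneracy of the Hessian at e turns this into vanishing of the relative velocity, and so of σ
(`ErrorSystem.tendsto_of_mem_compact`). The set 𝒮³ consists of the states with V < K_p τ_L on each
edge, which confines h to such a set; near the equilibrium the confinement is
`ErrorSystem.exists_trapping`.

Induction from the root along the tree turns convergence of the relative states into convergence to
the reference. Boundedness of v_r enters because Ad_{h⁻¹} - id → 0 has to be applied to the
velocities. Existence runs the other way: the decoupled error systems are solved, and the agents are
rebuilt from the root outwards (`exists_trajectory`). -/

set_option linter.unusedSectionVars false

noncomputable section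

namespace LieConsensus

/-! ### Calculus on the group in one chart at the identity, moved around by left translations -/

section Coordinates

variable (E : Type*) [NormedAddCommGroup E] [NormedSpace ℝ E]
variable {G : Type*} [TopologicalSpace G] [ChartedSpace E G] [Group G]
variable {F : Type*} [NormedAddCommGroup F] [NormedSpace ℝ F]
variable {W : Type*} [NormedAddCommGroup W] [NormedSpace ℝ W]

/-- The preferred chart around the identity. -/
def coord (g : G) : E := extChartAt 𝓘(ℝ, E) (1 : G) g

variable (G) in
/-- The coordinates of the identity. -/
def origin : E := coord E (1 : G)

variable {E}

variable (G) in
/-- The inverse of the preferred chart around the identity. -/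
def point (y : E) : G := (extChartAt 𝓘(ℝ, E) (1 : G)).symm y

@[simp] theorem point_origin : point G (origin E G) = 1 := by
  simp [point, origin, coord]

theorem coord_one : coord E (1 : G) = origin E G := rfl

theorem continuousAt_coord : ContinuousAt (coord E) (1 : G) :=
  continuousAt_extChartAt (I := 𝓘(ℝ, E)) (1 : G)

theorem target_mem_nhds_origin :
    (extChartAt 𝓘(ℝ, E) (1 : G)).target ∈ 𝓝 (origin E G) :=
  extChartAt_target_mem_nhds (I := 𝓘(ℝ, E)) (1 : G)

theorem eventually_coord_point : ∀ᶠ y in 𝓝 (origin E G), coord E (point G y) = y := by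
  filter_upwards [target_mem_nhds_origin (E := E) (G := G)] with y hy
  exact (extChartAt 𝓘(ℝ, E) (1 : G)).right_inv hy

theorem eventually_point_coord : ∀ᶠ g in 𝓝 (1 : G), point G (coord E g) = g := by
  filter_upwards [extChartAt_source_mem_nhds (I := 𝓘(ℝ, E)) (1 : G)] with g hg
  exact (extChartAt 𝓘(ℝ, E) (1 : G)).left_inv hg

theorem contMDiffAt_coord : ContMDiffAt 𝓘(ℝ, E) 𝓘(ℝ, E) ∞ (coord E) (1 : G) :=
  contMDiffAt_extChartAt (I := 𝓘(ℝ, E))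

variable [LieGroup 𝓘(ℝ, E) ∞ G]

theorem contMDiffAt_point : ContMDiffAt 𝓘(ℝ, E) 𝓘(ℝ, E) ∞ (point G) (origin E G) :=
  (contMDiffOn_extChartAt_symm (I := 𝓘(ℝ, E)) (1 : G)).contMDiffAt target_mem_nhds_origin

theorem continuousAt_point : ContinuousAt (point G) (origin E G) :=
  contMDiffAt_point.continuousAt

theorem contDiffAt_coord_comp {a : W → G} {w : W}
    (ha : ContMDiffAt 𝓘(ℝ, W) 𝓘(ℝ, E) ∞ a w) (h1 : a w = 1) :
    ContDiffAt ℝ ∞ (fun x => coord E (a x)) w := by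
  rw [← contMDiffAt_iff_contDiffAt]
  have h : ContMDiffAt 𝓘(ℝ, E) 𝓘(ℝ, E) ∞ (coord E) (a w) := by
    rw [h1]; exact contMDiffAt_coord
  exact h.comp w ha

theorem contMDiffAt_point_comp {a : W → E} {w : W}
    (ha : ContDiffAt ℝ ∞ a w) (h1 : a w = origin E G) :
    ContMDiffAt 𝓘(ℝ, W) 𝓘(ℝ, E) ∞ (fun x => point G (a x)) w := by
  have h : ContMDiffAt 𝓘(ℝ, E) 𝓘(ℝ, E) ∞ (point G) (a w) := by
    rw [h1]; exact contMDiffAt_point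
  exact h.comp w ha.contMDiffAt

variable (E) in
/-- Smoothness of a map from the group to a normed space, in left-translated coordinates. -/
def LeftSmooth (f : G → F) : Prop :=
  ∀ g, ContDiffAt ℝ ∞ (fun y : E => f (g * point G y)) (origin E G)

variable (E) in
/-- The differential of a function on the group, trivialized by left translations. -/
def leftDeriv (f : G → F) (g : G) : E →L[ℝ] F :=
  fderiv ℝ (fun y : E => f (g * point G y)) (origin E G)

theorem _root_.ContMDiff.leftSmooth {f : G → F} (hf : ContMDiff 𝓘(ℝ, E) 𝓘(ℝ, F) ∞ f) :
    LeftSmooth E f := by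
  intro g
  rw [← contMDiffAt_iff_contDiffAt]
  exact hf.contMDiffAt.comp _ (contMDiffAt_const.mul contMDiffAt_point)

variable (G) in
/-- The group multiplication in coordinates. -/
def coordMul (p : E × E) : E := coord E (point G p.1 * point G p.2)

theorem contDiffAt_coordMul : ContDiffAt ℝ ∞ (coordMul G) (origin E G, origin E G) := by
  refine contDiffAt_coord_comp (a := fun p : E × E => point G p.1 * point G p.2) ?_ (by simp)
  exact (contMDiffAt_point_comp contDiffAt_fst rfl).mul (contMDiffAt_point_comp contDiffAt_snd rfl)

@[simp] theorem coordMul_origin : coordMul G (origin E G, origin E G) = origin E G := by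
  simp [coordMul, coord_one]

theorem eventually_point_coordMul : ∀ᶠ p in 𝓝 (origin E G, origin E G),
    point G (coordMul G p) = point G p.1 * point G p.2 := by
  have h : Tendsto (fun p : E × E => point G p.1 * point G p.2)
      (𝓝 (origin E G, origin E G)) (𝓝 1) := by
    have := ((contMDiffAt_point_comp (G := G) (w := (origin E G, origin E G)) contDiffAt_fst rfl).mul
      (contMDiffAt_point_comp contDiffAt_snd rfl)).continuousAt
    simpa [ContinuousAt, Pi.mul_def] using this
  exact h.eventually eventually_point_coord

theorem LeftSmooth.continuous {f : G → F} (hf : LeftSmooth E f) : Continuous f := by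
  have : IsTopologicalGroup G := topologicalGroup_of_lieGroup 𝓘(ℝ, E) ∞
  rw [continuous_iff_continuousAt]
  intro g
  have h1 : Tendsto (fun x : G => g⁻¹ * x) (𝓝 g) (𝓝 1) := by
    have : Continuous fun x : G => g⁻¹ * x := by fun_prop
    simpa using this.tendsto g
  have h2 := (hf g).continuousAt
  have h3 : Tendsto (fun x : G => f (g * point G (coord E (g⁻¹ * x)))) (𝓝 g) (𝓝 (f g)) := by
    have := h2.tendsto.comp ((continuousAt_coord (E := E)).tendsto.comp h1)
    simpa [Function.comp_def] using this
  refine h3.congr' ?_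
  filter_upwards [h1.eventually (eventually_point_coord (E := E))] with x hx
  rw [hx]; simp

theorem eventually_apply_point_mul_point (f : G → F) (g : G) :
    ∀ᶠ p in 𝓝 (origin E G, origin E G),
      f (g * point G p.1 * point G p.2) = f (g * point G (coordMul G p)) := by
  filter_upwards [eventually_point_coordMul (E := E) (G := G)] with p hp
  rw [hp, mul_assoc]

/-- Near the identity the map is y ↦ f(g · y) composed with the smooth coordinate multiplication.
Joint smoothness is what permits differentiation in the second variable with the first as parameter,
so that `LeftSmooth` is stable under `leftDeriv`. -/
theorem LeftSmooth.contDiffAt_uncurry {f : G → F} (hf : LeftSmooth E f) (g : G) :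
    ContDiffAt ℝ ∞ (fun p : E × E => f (g * point G p.1 * point G p.2))
      (origin E G, origin E G) := by
  have h : ContDiffAt ℝ ∞ (fun y : E => f (g * point G y)) (coordMul G (origin E G, origin E G)) := by
    rw [coordMul_origin]; exact hf g
  exact (h.comp (origin E G, origin E G) contDiffAt_coordMul).congr_of_eventuallyEq
    (eventually_apply_point_mul_point f g)

theorem LeftSmooth.leftDeriv {f : G → F} (hf : LeftSmooth E f) :
    LeftSmooth E (leftDeriv E f) := by
  intro g
  exact ContDiffAt.fderiv (f := fun x y : E => f (g * point G x * point G y))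
    (hf.contDiffAt_uncurry g) contDiffAt_const (by simp)

theorem LeftSmooth.clm_comp {F' : Type*} [NormedAddCommGroup F'] [NormedSpace ℝ F']
    {f : G → F} (hf : LeftSmooth E f) (A : F →L[ℝ] F') : LeftSmooth E (fun g => A (f g)) :=
  fun g => A.contDiff.contDiffAt.comp _ (hf g)

/-- A curve in the group has, within `s` at `t`, the body velocity `ξ`. -/
def HasBodyVelocityWithinAt (γ : ℝ → G) (ξ : E) (s : Set ℝ) (t : ℝ) : Prop :=
  ContinuousWithinAt γ s t ∧ HasDerivWithinAt (fun r => coord E ((γ t)⁻¹ * γ r)) ξ s t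

/-- Chain rule with the chart at the identity only: near t, f ∘ γ is y ↦ f(γ(t) · y) evaluated at
the coordinates of γ(t)⁻¹ γ(r). -/
theorem HasBodyVelocityWithinAt.hasDerivWithinAt_comp {f : G → F} (hf : LeftSmooth E f)
    {γ : ℝ → G} {ξ : E} {s : Set ℝ} {t : ℝ} (h : HasBodyVelocityWithinAt γ ξ s t) :
    HasDerivWithinAt (fun r => f (γ r)) (leftDeriv E f (γ t) ξ) s t := by
  have : IsTopologicalGroup G := topologicalGroup_of_lieGroup 𝓘(ℝ, E) ∞
  have h1 : HasFDerivAt (fun y : E => f (γ t * point G y)) (LieConsensus.leftDeriv E f (γ t))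
      (coord E ((γ t)⁻¹ * γ t)) := by
    rw [inv_mul_cancel, coord_one]
    exact ((hf (γ t)).differentiableAt (by simp)).hasFDerivAt
  have h2 := h1.comp_hasDerivWithinAt t h.2
  have h3 : Tendsto (fun r => (γ t)⁻¹ * γ r) (𝓝[s] t) (𝓝 1) := by
    have : Tendsto (fun r => (γ t)⁻¹ * γ r) (𝓝[s] t) (𝓝 ((γ t)⁻¹ * γ t)) := h.1.const_mul _
    simpa using this
  refine h2.congr_of_eventuallyEq ?_ ?_
  · filter_upwards [h3.eventually (eventually_point_coord (E := E))] with r hr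
    simp [hr]
  · simp [coord_one]

end Coordinates

/-! ### Translations, adjoint action, bracket and body velocities in coordinates -/

section Frames

variable {E : Type*} [NormedAddCommGroup E] [NormedSpace ℝ E]
variable {G : Type*} [TopologicalSpace G] [ChartedSpace E G] [Group G]
variable {F : Type*} [NormedAddCommGroup F] [NormedSpace ℝ F]
variable [LieGroup 𝓘(ℝ, E) ∞ G]

variable (G) in
/-- The differential at the identity of the left translation by `point G y`, in coordinates. -/
def leftFrame (y : E) : E →L[ℝ] E := fderiv ℝ (fun z => coordMul G (y, z)) (origin E G)

variable (G) in
/-- The differential at the identity of the right translation by `point G y`, in coordinates. -/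
def rightFrame (y : E) : E →L[ℝ] E := fderiv ℝ (fun z => coordMul G (z, y)) (origin E G)

theorem eventually_coordMul_right : ∀ᶠ y in 𝓝 (origin E G), coordMul G (y, origin E G) = y := by
  filter_upwards [eventually_coord_point (E := E) (G := G)] with y hy
  simp [coordMul, hy]

theorem eventually_coordMul_left : ∀ᶠ y in 𝓝 (origin E G), coordMul G (origin E G, y) = y := by
  filter_upwards [eventually_coord_point (E := E) (G := G)] with y hy
  simp [coordMul, hy]

theorem leftFrame_origin : leftFrame G (origin E G) = ContinuousLinearMap.id ℝ E := by
  rw [leftFrame, Filter.EventuallyEq.fderiv_eq (f := fun y : E => y) eventually_coordMul_left]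
  exact fderiv_id

theorem rightFrame_origin : rightFrame G (origin E G) = ContinuousLinearMap.id ℝ E := by
  rw [rightFrame, Filter.EventuallyEq.fderiv_eq (f := fun y : E => y) eventually_coordMul_right]
  exact fderiv_id

theorem contDiffAt_leftFrame : ContDiffAt ℝ ∞ (leftFrame (E := E) G) (origin E G) :=
  ContDiffAt.fderiv (f := fun x y : E => coordMul G (x, y)) contDiffAt_coordMul
    contDiffAt_const (by simp)

theorem contDiffAt_rightFrame : ContDiffAt ℝ ∞ (rightFrame (E := E) G) (origin E G) := by
  refine ContDiffAt.fderiv (n := ∞) (f := fun x y : E => coordMul G (y, x)) ?_ contDiffAt_const (by simp)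
  exact (contDiffAt_coordMul (E := E) (G := G)).comp (origin E G, origin E G)
    (contDiffAt_snd.prodMk contDiffAt_fst)

theorem eventually_differentiableAt_coordMul :
    ∀ᶠ p in 𝓝 (origin E G, origin E G), DifferentiableAt ℝ (coordMul (E := E) G) p := by
  have h : ContDiffAt ℝ 1 (coordMul (E := E) G) (origin E G, origin E G) :=
    contDiffAt_coordMul.of_le (by simp)
  filter_upwards [h.eventually (by simp)] with p hp
  exact hp.differentiableAt (by simp)

theorem tendsto_prodMk_origin :
    Tendsto (fun y : E => (y, origin E G)) (𝓝 (origin E G)) (𝓝 (origin E G, origin E G)) :=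
  (Continuous.prodMk_left (origin E G)).tendsto _

theorem tendsto_origin_prodMk :
    Tendsto (fun y : E => (origin E G, y)) (𝓝 (origin E G)) (𝓝 (origin E G, origin E G)) :=
  (Continuous.prodMk_right (origin E G)).tendsto _

theorem eventually_leftFrame_eq : ∀ᶠ y in 𝓝 (origin E G), leftFrame G y =
    (fderiv ℝ (coordMul G) (y, origin E G)).comp (ContinuousLinearMap.inr ℝ E E) := by
  filter_upwards [(tendsto_prodMk_origin (E := E) (G := G)).eventually
    eventually_differentiableAt_coordMul] with y hy
  exact (hy.hasFDerivAt.comp (origin E G) (hasFDerivAt_prodMk_right y (origin E G))).fderiv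

theorem eventually_rightFrame_eq : ∀ᶠ y in 𝓝 (origin E G), rightFrame G y =
    (fderiv ℝ (coordMul G) (origin E G, y)).comp (ContinuousLinearMap.inl ℝ E E) := by
  filter_upwards [(tendsto_origin_prodMk (E := E) (G := G)).eventually
    eventually_differentiableAt_coordMul] with y hy
  exact (HasFDerivAt.comp (f := fun e => (e, y)) (origin E G) hy.hasFDerivAt
    (hasFDerivAt_prodMk_left (origin E G) y)).fderiv

theorem hasFDerivAt_coordMul :
    HasFDerivAt (coordMul (E := E) G)
      (ContinuousLinearMap.fst ℝ E E + ContinuousLinearMap.snd ℝ E E)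
      (origin E G, origin E G) := by
  have h := (eventually_differentiableAt_coordMul (E := E) (G := G)).self_of_nhds.hasFDerivAt
  have hl := (eventually_leftFrame_eq (E := E) (G := G)).self_of_nhds
  have hr := (eventually_rightFrame_eq (E := E) (G := G)).self_of_nhds
  rw [leftFrame_origin] at hl
  rw [rightFrame_origin] at hr
  convert h using 1
  ext x
  · simpa using congrArg (fun A : E →L[ℝ] E => A x) hr
  · simpa using congrArg (fun A : E →L[ℝ] E => A x) hl

theorem fderiv_leftFrame_apply (v w : E) :
    fderiv ℝ (leftFrame G) (origin E G) v w =
      fderiv ℝ (fderiv ℝ (coordMul G)) (origin E G, origin E G) (v, 0) (0, w) := by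
  have h : ContDiffAt ℝ 1 (fderiv ℝ (coordMul (E := E) G)) (origin E G, origin E G) :=
    contDiffAt_coordMul.fderiv_right (m := 1) (n := ∞) (by rw [one_add_one_eq_two]; exact ENat.LEInfty.out)
  have h1 : HasFDerivAt (fun y : E => fderiv ℝ (coordMul G) (y, origin E G)) _ (origin E G) :=
    HasFDerivAt.comp (f := fun y => (y, origin E G)) (origin E G)
      (h.differentiableAt (by simp)).hasFDerivAt (hasFDerivAt_prodMk_left (origin E G) (origin E G))
  have h2 := h1.clm_comp (hasFDerivAt_const (ContinuousLinearMap.inr ℝ E E) (origin E G))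
  rw [(h2.congr_of_eventuallyEq eventually_leftFrame_eq).fderiv]
  simp

theorem fderiv_rightFrame_apply (v w : E) :
    fderiv ℝ (rightFrame G) (origin E G) v w =
      fderiv ℝ (fderiv ℝ (coordMul G)) (origin E G, origin E G) (0, v) (w, 0) := by
  have h : ContDiffAt ℝ 1 (fderiv ℝ (coordMul (E := E) G)) (origin E G, origin E G) :=
    contDiffAt_coordMul.fderiv_right (m := 1) (n := ∞) (by rw [one_add_one_eq_two]; exact ENat.LEInfty.out)
  have h1 : HasFDerivAt (fun y : E => fderiv ℝ (coordMul G) (origin E G, y)) _ (origin E G) :=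
    (h.differentiableAt (by simp)).hasFDerivAt.comp (origin E G)
      (hasFDerivAt_prodMk_right (origin E G) (origin E G))
  have h2 := h1.clm_comp (hasFDerivAt_const (ContinuousLinearMap.inl ℝ E E) (origin E G))
  rw [(h2.congr_of_eventuallyEq eventually_rightFrame_eq).fderiv]
  simp

/-- Both sides are mixed second derivatives of the multiplication at the origin, hence equal by
symmetry of the second derivative. -/
theorem fderiv_rightFrame_eq (v w : E) :
    fderiv ℝ (rightFrame G) (origin E G) v w = fderiv ℝ (leftFrame G) (origin E G) w v := by
  rw [fderiv_rightFrame_apply, fderiv_leftFrame_apply]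
  have h : ContDiffAt ℝ 2 (coordMul (E := E) G) (origin E G, origin E G) :=
    contDiffAt_coordMul.of_le ENat.LEInfty.out
  exact (h.isSymmSndFDerivAt (by simp)).eq _ _

/-! ### The adjoint action -/

variable (E) in
/-- The adjoint action in coordinates. -/
def adAct (g : G) : E →L[ℝ] E :=
  fderiv ℝ (fun y => coord E (g * point G y * g⁻¹)) (origin E G)

theorem contDiffAt_conj (g : G) :
    ContDiffAt ℝ ∞ (fun y => coord E (g * point G y * g⁻¹)) (origin E G) :=
  contDiffAt_coord_comp ((contMDiffAt_const.mul contMDiffAt_point).mul contMDiffAt_const) (by simp)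

theorem hasFDerivAt_conj (g : G) :
    HasFDerivAt (fun y => coord E (g * point G y * g⁻¹)) (adAct E g) (origin E G) :=
  ((contDiffAt_conj g).differentiableAt (by simp)).hasFDerivAt

theorem tendsto_conj (g : G) :
    Tendsto (fun y : E => g * point G y * g⁻¹) (𝓝 (origin E G)) (𝓝 1) := by
  have : IsTopologicalGroup G := topologicalGroup_of_lieGroup 𝓘(ℝ, E) ∞
  have h : Tendsto (fun y : E => g * point G y * g⁻¹) (𝓝 (origin E G))
      (𝓝 (g * point G (origin E G) * g⁻¹)) :=
    (continuousAt_point.tendsto.const_mul g).mul_const g⁻¹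
  simpa using h

theorem adAct_mul (g h : G) : adAct E (g * h) = (adAct E g).comp (adAct E h) := by
  have hg : HasFDerivAt (fun y => coord E (g * point G y * g⁻¹)) (adAct E g)
      (coord E (h * point G (origin E G) * h⁻¹)) := by
    simpa [coord_one] using hasFDerivAt_conj (E := E) g
  refine HasFDerivAt.fderiv ((hg.comp (origin E G) (hasFDerivAt_conj h)).congr_of_eventuallyEq ?_)
  filter_upwards [(tendsto_conj (E := E) h).eventually (eventually_point_coord (E := E))] with y hy
  simp only [Function.comp_apply, hy]
  congr 1
  group

theorem adAct_one : adAct E (1 : G) = ContinuousLinearMap.id ℝ E := by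
  rw [adAct, Filter.EventuallyEq.fderiv_eq (f := fun y : E => y)
    (eventually_coord_point.mono (fun y hy => by simpa using hy))]
  exact fderiv_id

theorem adAct_comp_inv (g : G) :
    (adAct E g).comp (adAct E g⁻¹) = ContinuousLinearMap.id ℝ E := by
  rw [← adAct_mul, mul_inv_cancel, adAct_one]

theorem contDiffAt_adAct_point :
    ContDiffAt ℝ ∞ (fun x : E => adAct E (point G x)) (origin E G) := by
  refine ContDiffAt.fderiv (n := ∞)
    (f := fun x y : E => coord E (point G x * point G y * (point G x)⁻¹)) ?_ contDiffAt_const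
    (by simp)
  refine contDiffAt_coord_comp
    (a := fun p : E × E => point G p.1 * point G p.2 * (point G p.1)⁻¹) ?_ (by simp)
  exact ((contMDiffAt_point_comp contDiffAt_fst rfl).mul
    (contMDiffAt_point_comp contDiffAt_snd rfl)).mul (contMDiffAt_point_comp contDiffAt_fst rfl).inv

theorem contDiffAt_adAct_point_inv :
    ContDiffAt ℝ ∞ (fun x : E => adAct E (point G x)⁻¹) (origin E G) := by
  refine ContDiffAt.fderiv (n := ∞)
    (f := fun x y : E => coord E ((point G x)⁻¹ * point G y * ((point G x)⁻¹)⁻¹)) ?_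
    contDiffAt_const (by simp)
  refine contDiffAt_coord_comp
    (a := fun p : E × E => (point G p.1)⁻¹ * point G p.2 * ((point G p.1)⁻¹)⁻¹) ?_ (by simp)
  exact ((contMDiffAt_point_comp contDiffAt_fst rfl).inv.mul
    (contMDiffAt_point_comp contDiffAt_snd rfl)).mul
    (contMDiffAt_point_comp contDiffAt_fst rfl).inv.inv

theorem leftSmooth_adAct_inv : LeftSmooth E (fun g : G => adAct E g⁻¹) := by
  intro g
  have h : (fun y : E => adAct E (g * point G y)⁻¹) =
      fun y => (adAct E (point G y)⁻¹).comp (adAct E g⁻¹) := by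
    funext y
    rw [mul_inv_rev, adAct_mul]
  rw [h]
  exact contDiffAt_adAct_point_inv.clm_comp contDiffAt_const

/-- Differentiate x y = (x y x⁻¹) x in y at the identity. -/
theorem eventually_rightFrame_comp_adAct : ∀ᶠ x in 𝓝 (origin E G),
    (rightFrame G x).comp (adAct E (point G x)) = leftFrame G x := by
  have h1 : Tendsto (fun p : E × E => point G p.1 * point G p.2 * (point G p.1)⁻¹)
      (𝓝 (origin E G, origin E G)) (𝓝 1) := by
    have := (((contMDiffAt_point_comp (G := G) (w := (origin E G, origin E G))
      contDiffAt_fst rfl).mul (contMDiffAt_point_comp contDiffAt_snd rfl)).mul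
      (contMDiffAt_point_comp contDiffAt_fst rfl).inv).continuousAt
    simpa [ContinuousAt, Pi.mul_def] using this
  have h2 := h1.eventually (eventually_point_coord (E := E))
  -- A property near the pair becomes an iterated one: for every x near the origin it holds for all
  -- y near the origin, which allows differentiation in y at fixed x.
  rw [nhds_prod_eq] at h2
  filter_upwards [h2.curry, (tendsto_origin_prodMk (E := E) (G := G)).eventually
    eventually_differentiableAt_coordMul] with x hx hd
  have hR : HasFDerivAt (fun z => coordMul G (z, x)) (rightFrame G x)
      (coord E (point G x * point G (origin E G) * (point G x)⁻¹)) := by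
    have : DifferentiableAt ℝ (fun z => coordMul G (z, x)) (origin E G) :=
      (HasFDerivAt.comp (g := coordMul G) (f := fun e => (e, x)) (origin E G) hd.hasFDerivAt
        (hasFDerivAt_prodMk_left (origin E G) x)).differentiableAt
    simpa [coord_one, rightFrame] using this.hasFDerivAt
  refine ((hR.comp (origin E G) (hasFDerivAt_conj (point G x))).congr_of_eventuallyEq ?_).fderiv.symm
  filter_upwards [hx] with y hy
  simp [coordMul, hy]

/-- Differentiate R_x ∘ Ad_x = L_x at the origin, where all three factors are the identity. -/
theorem hasFDerivAt_adAct_point :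
    HasFDerivAt (fun x : E => adAct E (point G x))
      (fderiv ℝ (leftFrame G) (origin E G) - fderiv ℝ (rightFrame G) (origin E G))
      (origin E G) := by
  have hA := (contDiffAt_adAct_point (E := E) (G := G)).differentiableAt (by simp) |>.hasFDerivAt
  have hR := (contDiffAt_rightFrame (E := E) (G := G)).differentiableAt (by simp) |>.hasFDerivAt
  have hL := (contDiffAt_leftFrame (E := E) (G := G)).differentiableAt (by simp) |>.hasFDerivAt
  have h := (hR.clm_comp hA).congr_of_eventuallyEq (f₁ := leftFrame G)
    (eventually_rightFrame_comp_adAct.mono fun x hx => hx.symm)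
  have h2 := hL.unique h
  have h3 : fderiv ℝ (fun x : E => adAct E (point G x)) (origin E G) =
      fderiv ℝ (leftFrame G) (origin E G) - fderiv ℝ (rightFrame G) (origin E G) := by
    ext v w
    rw [h2]
    simp [rightFrame_origin, adAct_one]
  rwa [h3] at hA

variable (G) in
/-- The bracket of the Lie algebra in coordinates. -/
def coordBracket (v w : E) : E :=
  fderiv ℝ (leftFrame G) (origin E G) v w - fderiv ℝ (leftFrame G) (origin E G) w v

/-- Differentiating Ad_x ∘ Ad_{x⁻¹} = id shows that the derivatives of Ad_x and Ad_{x⁻¹} at the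
identity are opposite; the former is the bracket by symmetry of the mixed second derivative. -/
theorem fderiv_adAct_point_inv_apply (v w : E) :
    fderiv ℝ (fun x : E => adAct E (point G x)⁻¹) (origin E G) v w = - coordBracket G v w := by
  have hA := hasFDerivAt_adAct_point (E := E) (G := G)
  have hB := (contDiffAt_adAct_point_inv (E := E) (G := G)).differentiableAt (by simp) |>.hasFDerivAt
  have h := hA.clm_comp hB
  have h2 : (fun x : E => (adAct E (point G x)).comp (adAct E (point G x)⁻¹)) =
      fun _ => ContinuousLinearMap.id ℝ E := by
    funext x; exact adAct_comp_inv _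
  rw [h2] at h
  have h3 := congrArg (fun A : E →L[ℝ] E →L[ℝ] E => A v w)
    (h.unique (hasFDerivAt_const (ContinuousLinearMap.id ℝ E) (origin E G)))
  simp [adAct_one] at h3
  rw [coordBracket, ← fderiv_rightFrame_eq v w]
  exact eq_neg_of_add_eq_zero_left h3

theorem leftDeriv_adAct_inv_apply (g : G) (v w : E) :
    leftDeriv E (fun x : G => adAct E x⁻¹) g v w = - coordBracket G v (adAct E g⁻¹ w) := by
  have hB := (contDiffAt_adAct_point_inv (E := E) (G := G)).differentiableAt (by simp) |>.hasFDerivAt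
  have h := hB.clm_comp (hasFDerivAt_const (adAct E g⁻¹) (origin E G))
  have h2 : (fun y : E => adAct E (g * point G y)⁻¹) =
      fun y => (adAct E (point G y)⁻¹).comp (adAct E g⁻¹) := by
    funext y
    rw [mul_inv_rev, adAct_mul]
  rw [leftDeriv, h2, h.fderiv]
  simpa using fderiv_adAct_point_inv_apply v (adAct E g⁻¹ w)

/-! ### Body velocities -/

theorem HasBodyVelocityWithinAt.tendsto_inv_mul {γ : ℝ → G} {ξ : E} {s : Set ℝ} {t : ℝ}
    (h : HasBodyVelocityWithinAt γ ξ s t) :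
    Tendsto (fun r => (γ t)⁻¹ * γ r) (𝓝[s] t) (𝓝 1) := by
  have : IsTopologicalGroup G := topologicalGroup_of_lieGroup 𝓘(ℝ, E) ∞
  have : Tendsto (fun r => (γ t)⁻¹ * γ r) (𝓝[s] t) (𝓝 ((γ t)⁻¹ * γ t)) := h.1.const_mul _
  simpa using this

theorem HasBodyVelocityWithinAt.hasDerivWithinAt_conj {γ : ℝ → G} {ξ : E} {s : Set ℝ} {t : ℝ}
    (h : HasBodyVelocityWithinAt γ ξ s t) (g : G) :
    HasDerivWithinAt (fun r => coord E (g * ((γ t)⁻¹ * γ r) * g⁻¹)) (adAct E g ξ) s t := by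
  have h1 : HasFDerivAt (fun y => coord E (g * point G y * g⁻¹)) (adAct E g)
      (coord E ((γ t)⁻¹ * γ t)) := by
    simpa [coord_one] using hasFDerivAt_conj (E := E) g
  refine (h1.comp_hasDerivWithinAt t h.2).congr_of_eventuallyEq ?_ ?_
  · filter_upwards [h.tendsto_inv_mul.eventually (eventually_point_coord (E := E))] with r hr
    simp only [Function.comp_apply, hr]
  · simp [coord_one]

/-- Based at time t, the product curve is η(t)⁻¹ (γ(t)⁻¹ γ(r)) η(t) times η(t)⁻¹ η(r). Both factors
pass through the identity, where the multiplication has differential (a, b) ↦ a + b. -/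
theorem HasBodyVelocityWithinAt.mul {γ η : ℝ → G} {ξ ζ : E} {s : Set ℝ} {t : ℝ}
    (hγ : HasBodyVelocityWithinAt γ ξ s t) (hη : HasBodyVelocityWithinAt η ζ s t) :
    HasBodyVelocityWithinAt (fun r => γ r * η r) (adAct E (η t)⁻¹ ξ + ζ) s t := by
  have : IsTopologicalGroup G := topologicalGroup_of_lieGroup 𝓘(ℝ, E) ∞
  refine ⟨hγ.1.mul hη.1, ?_⟩
  have h1 := hγ.hasDerivWithinAt_conj (η t)⁻¹
  have h2 : HasFDerivAt (coordMul (E := E) G)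
      (ContinuousLinearMap.fst ℝ E E + ContinuousLinearMap.snd ℝ E E)
      (coord E ((η t)⁻¹ * ((γ t)⁻¹ * γ t) * ((η t)⁻¹)⁻¹), coord E ((η t)⁻¹ * η t)) := by
    simpa [coord_one] using hasFDerivAt_coordMul (E := E) (G := G)
  have h3 : Tendsto (fun r => (η t)⁻¹ * ((γ t)⁻¹ * γ r) * ((η t)⁻¹)⁻¹) (𝓝[s] t) (𝓝 1) := by
    simpa using (hγ.tendsto_inv_mul.const_mul (η t)⁻¹).mul_const ((η t)⁻¹)⁻¹
  refine (h2.comp_hasDerivWithinAt t (h1.prodMk hη.2)).congr_of_eventuallyEq ?_ ?_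
  · filter_upwards [h3.eventually (eventually_point_coord (E := E)),
      hη.tendsto_inv_mul.eventually (eventually_point_coord (E := E))] with r hr hr'
    simp only [Function.comp_apply, coordMul, hr, hr']
    congr 1
    group
  · simp [coordMul, coord_one]

theorem hasFDerivAt_coord_inv :
    HasFDerivAt (fun y => coord E (point G y)⁻¹) (-ContinuousLinearMap.id ℝ E) (origin E G) := by
  have hc : ContDiffAt ℝ ∞ (fun y => coord E (point G y)⁻¹) (origin E G) :=
    contDiffAt_coord_comp contMDiffAt_point.inv (by simp)
  have hI := (hc.differentiableAt (by simp)).hasFDerivAt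
  have hm : HasFDerivAt (coordMul (E := E) G)
      (ContinuousLinearMap.fst ℝ E E + ContinuousLinearMap.snd ℝ E E)
      (origin E G, coord E (point G (origin E G))⁻¹) := by
    simpa [coord_one] using hasFDerivAt_coordMul (E := E) (G := G)
  have h := hm.comp (origin E G) ((hasFDerivAt_id (origin E G)).prodMk hI)
  have ht : Tendsto (fun y : E => (point G y)⁻¹) (𝓝 (origin E G)) (𝓝 1) := by
    have := (contMDiffAt_point (E := E) (G := G)).inv.continuousAt
    simpa [ContinuousAt] using this
  have h2 : HasFDerivAt (fun _ : E => origin E G) (0 : E →L[ℝ] E) (origin E G) :=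
    hasFDerivAt_const _ _
  have h3 := h.unique (h2.congr_of_eventuallyEq ?_)
  · convert hI using 1
    ext v
    have := congrArg (fun A : E →L[ℝ] E => A v) h3
    simp at this
    simpa using neg_eq_of_add_eq_zero_right this
  · filter_upwards [ht.eventually (eventually_point_coord (E := E))] with y hy
    simp [coordMul, hy, coord_one]

theorem HasBodyVelocityWithinAt.inv {γ : ℝ → G} {ξ : E} {s : Set ℝ} {t : ℝ}
    (h : HasBodyVelocityWithinAt γ ξ s t) :
    HasBodyVelocityWithinAt (fun r => (γ r)⁻¹) (-adAct E (γ t) ξ) s t := by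
  have : IsTopologicalGroup G := topologicalGroup_of_lieGroup 𝓘(ℝ, E) ∞
  refine ⟨h.1.inv, ?_⟩
  have h1 := h.hasDerivWithinAt_conj (γ t)
  have h2 : HasFDerivAt (fun y => coord E (point G y)⁻¹) (-ContinuousLinearMap.id ℝ E)
      (coord E (γ t * ((γ t)⁻¹ * γ t) * (γ t)⁻¹)) := by
    simpa [coord_one] using hasFDerivAt_coord_inv (E := E) (G := G)
  have h3 : Tendsto (fun r => γ t * ((γ t)⁻¹ * γ r) * (γ t)⁻¹) (𝓝[s] t) (𝓝 1) := by
    simpa using (h.tendsto_inv_mul.const_mul (γ t)).mul_const (γ t)⁻¹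
  have h4 := h2.comp_hasDerivWithinAt t h1
  simp only [_root_.neg_apply, ContinuousLinearMap.id_apply] at h4
  refine h4.congr_of_eventuallyEq ?_ ?_
  · filter_upwards [h3.eventually (eventually_point_coord (E := E))] with r hr
    simp only [Function.comp_apply, hr]
    congr 1
    group
  · simp [coord_one]

theorem HasBodyVelocityWithinAt.inv_mul {γ η : ℝ → G} {ξ ζ : E} {s : Set ℝ} {t : ℝ}
    (hγ : HasBodyVelocityWithinAt γ ξ s t) (hη : HasBodyVelocityWithinAt η ζ s t) :
    HasBodyVelocityWithinAt (fun r => (γ r)⁻¹ * η r) (ζ - adAct E ((η t)⁻¹ * γ t) ξ) s t := by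
  have h := hγ.inv.mul hη
  rwa [map_neg, ← ContinuousLinearMap.comp_apply, ← adAct_mul, neg_add_eq_sub] at h

/-- The origin of the bracket term in the controller: it is the part of the derivative of Ad_{γ⁻¹} w
due to the motion of γ. -/
theorem HasBodyVelocityWithinAt.hasDerivWithinAt_adAct_inv {γ : ℝ → G} {ξ : E} {s : Set ℝ} {t : ℝ}
    (hγ : HasBodyVelocityWithinAt γ ξ s t) {w : ℝ → E} {w' : E} (hw : HasDerivWithinAt w w' s t) :
    HasDerivWithinAt (fun r => adAct E (γ r)⁻¹ (w r))
      (adAct E (γ t)⁻¹ w' - coordBracket G ξ (adAct E (γ t)⁻¹ (w t))) s t := by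
  have h := (hγ.hasDerivWithinAt_comp leftSmooth_adAct_inv).clm_apply hw
  rw [leftDeriv_adAct_inv_apply] at h
  convert h using 1
  abel

end Frames

/-! ### Agreement of the coordinate objects with the manifold derivatives, Ad and the Lie bracket -/

section Bridge

variable {E : Type*} [NormedAddCommGroup E] [NormedSpace ℝ E]
variable {G : Type*} [TopologicalSpace G] [ChartedSpace E G] [Group G]
variable {F : Type*} [NormedAddCommGroup F] [NormedSpace ℝ F]

theorem hasFDerivAt_of_hasMFDerivAt_one {f : G → F} {A : E →L[ℝ] F}
    (h : HasMFDerivAt 𝓘(ℝ, E) 𝓘(ℝ, F) f (1 : G) A) :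
    HasFDerivAt (fun y : E => f (point G y)) A (origin E G) := by
  have h2 : HasFDerivWithinAt (fun y : E => f (point G y)) A (range 𝓘(ℝ, E)) (origin E G) := h.2
  rwa [ModelWithCorners.range_eq_univ, hasFDerivWithinAt_univ] at h2

theorem hasFDerivAt_coord_of_hasMFDerivAt_one {a : G → G} {A : E →L[ℝ] E} {x : G}
    (h : HasMFDerivAt 𝓘(ℝ, E) 𝓘(ℝ, E) a (1 : G) A) (hx : a 1 = x) :
    HasFDerivAt (fun y : E => extChartAt 𝓘(ℝ, E) x (a (point G y))) A (origin E G) := by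
  subst hx
  have h2 : HasFDerivWithinAt (fun y : E => extChartAt 𝓘(ℝ, E) (a 1) (a (point G y))) A
    (range 𝓘(ℝ, E)) (origin E G) := h.2
  rwa [ModelWithCorners.range_eq_univ, hasFDerivWithinAt_univ] at h2

theorem hasDerivWithinAt_coord_of_hasMFDerivWithinAt {k : ℝ → G} {ξ : E} {s : Set ℝ} {t : ℝ} {x : G}
    (h : HasMFDerivWithinAt 𝓘(ℝ, ℝ) 𝓘(ℝ, E) k s t (ContinuousLinearMap.toSpanSingleton ℝ ξ))
    (hx : k t = x) :
    HasDerivWithinAt (fun r => extChartAt 𝓘(ℝ, E) x (k r)) ξ s t := by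
  have h2 := h.2
  subst hx
  rw [hasDerivWithinAt_iff_hasFDerivWithinAt]
  simp only [writtenInExtChartAt, extChartAt_model_space_eq_id, PartialEquiv.refl_symm,
    PartialEquiv.refl_coe, Function.comp_id, modelWithCornersSelf_coe, range_id, inter_univ,
    preimage_id] at h2
  exact h2

theorem hasMFDerivWithinAt_of_hasDerivWithinAt_coord {k : ℝ → G} {ξ : E} {s : Set ℝ} {t : ℝ} {x : G}
    (hc : ContinuousWithinAt k s t)
    (h : HasDerivWithinAt (fun r => extChartAt 𝓘(ℝ, E) x (k r)) ξ s t)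
    (hx : k t = x) :
    HasMFDerivWithinAt 𝓘(ℝ, ℝ) 𝓘(ℝ, E) k s t (ContinuousLinearMap.toSpanSingleton ℝ ξ) := by
  subst hx
  refine ⟨hc, ?_⟩
  simp only [writtenInExtChartAt, extChartAt_model_space_eq_id, PartialEquiv.refl_symm,
    PartialEquiv.refl_coe, Function.comp_id, modelWithCornersSelf_coe, range_id, inter_univ,
    preimage_id]
  exact h.hasFDerivWithinAt

variable [LieGroup 𝓘(ℝ, E) ∞ G]

theorem mdifferentiable_mul_left (g : G) :
    MDifferentiable 𝓘(ℝ, E) 𝓘(ℝ, E) (fun x : G => g * x) :=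
  (contMDiff_mul_left (I := 𝓘(ℝ, E)) (n := ∞)).mdifferentiable (by simp)

theorem hasMFDerivAt_tangentLeft (g : G) :
    HasMFDerivAt 𝓘(ℝ, E) 𝓘(ℝ, E) (fun x : G => g * x) (1 : G) (tangentLeft (E := E) g) :=
  (mdifferentiable_mul_left (E := E) g 1).hasMFDerivAt

theorem pullLeft_differential {f : G → ℝ} (hf : MDifferentiable 𝓘(ℝ, E) 𝓘(ℝ, ℝ) f) (g : G) (v : E) :
    pullLeft (E := E) g (differential f g) v =
      fderiv ℝ (fun y : E => f (g * point G y)) (origin E G) v := by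
  have h1 : HasMFDerivAt 𝓘(ℝ, E) 𝓘(ℝ, ℝ) f (g * 1) (differential (E := E) f (g * 1)) :=
    (hf (g * 1)).hasMFDerivAt
  have h2 := h1.comp (1 : G) (hasMFDerivAt_tangentLeft g)
  have h3 := hasFDerivAt_of_hasMFDerivAt_one h2
  have h4 : HasFDerivAt (fun y : E => f (g * point G y)) _ (origin E G) := h3
  rw [h4.fderiv, mul_one]
  rfl

/-- Left translation is invertible: f = (f ∘ L_g) ∘ L_{g⁻¹}, and f ∘ L_g has zero differential at
the identity. -/
theorem differential_eq_zero {f : G → ℝ} (hf : MDifferentiable 𝓘(ℝ, E) 𝓘(ℝ, ℝ) f) (g : G)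
    (h : leftDeriv E f g = 0) : differential (E := E) f g = 0 := by
  have h1 : HasMFDerivAt 𝓘(ℝ, E) 𝓘(ℝ, ℝ) f (g * 1) (differential (E := E) f (g * 1)) :=
    (hf (g * 1)).hasMFDerivAt
  have h2 := h1.comp (1 : G) (hasMFDerivAt_tangentLeft g)
  have h3 : HasFDerivAt (fun y : E => f (g * point G y)) _ (origin E G) :=
    hasFDerivAt_of_hasMFDerivAt_one h2
  have h4 : ((differential (E := E) f (g * 1)).comp (tangentLeft (E := E) g) : E →L[ℝ] ℝ) = 0 := by
    rw [leftDeriv, h3.fderiv] at h; exact h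
  have h5 : HasMFDerivAt 𝓘(ℝ, E) 𝓘(ℝ, ℝ) (f ∘ fun x => g * x) (g⁻¹ * g) (0 : E →L[ℝ] ℝ) := by
    rw [inv_mul_cancel]
    rw [← h4]
    exact h2
  have h6 := h5.comp g (mdifferentiable_mul_left (E := E) g⁻¹ g).hasMFDerivAt
  have h7 : (f ∘ fun x => g * x) ∘ (fun x => g⁻¹ * x) = f := by
    funext x; simp
  rw [h7] at h6
  have h8 := h6.mfderiv
  rw [differential, h8]
  exact ContinuousLinearMap.zero_comp _

theorem Ad_apply_eq (g : G) (v : E) : (Ad (E := E) g v : E) = adAct E g v := by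
  have h1 : MDifferentiable 𝓘(ℝ, E) 𝓘(ℝ, E) (fun x : G => g * x * g⁻¹) :=
    (((contMDiff_const (I := 𝓘(ℝ, E)) (n := ∞)).mul contMDiff_id).mul
      contMDiff_const).mdifferentiable (by simp)
  have h2 := hasFDerivAt_coord_of_hasMFDerivAt_one (h1 1).hasMFDerivAt (x := 1) (by simp)
  rw [adAct]
  have h3 : HasFDerivAt (fun y : E => coord E (g * point G y * g⁻¹)) _ (origin E G) := h2
  rw [h3.fderiv]
  rfl

theorem clm_comp_toSpanSingleton {E F : Type*} [NormedAddCommGroup E] [NormedSpace ℝ E]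
    [NormedAddCommGroup F] [NormedSpace ℝ F] (A : E →L[ℝ] F) (x : E) :
    A.comp (ContinuousLinearMap.toSpanSingleton ℝ x) =
      ContinuousLinearMap.toSpanSingleton ℝ (A x) :=
  A.comp_toSpanSingleton x

/-- Composition with L_{γ(t)⁻¹} or L_{γ(t)} moves the curve between γ(t) and the identity, and the
two tangent maps are inverse to each other. -/
theorem hasMFDerivWithinAt_iff_hasBodyVelocityWithinAt {γ : ℝ → G} {ξ : E} {s : Set ℝ} {t : ℝ} :
    HasMFDerivWithinAt 𝓘(ℝ, ℝ) 𝓘(ℝ, E) γ s t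
      (ContinuousLinearMap.toSpanSingleton ℝ (tangentLeft (E := E) (γ t) ξ)) ↔
    HasBodyVelocityWithinAt γ ξ s t := by
  have hG : IsTopologicalGroup G := topologicalGroup_of_lieGroup 𝓘(ℝ, E) ∞
  constructor
  · intro h
    refine ⟨h.1, ?_⟩
    have h1 := (mdifferentiable_mul_left (E := E) (γ t)⁻¹ (γ t)).hasMFDerivAt.comp_hasMFDerivWithinAt
      t h
    have h2 : HasMFDerivAt 𝓘(ℝ, E) 𝓘(ℝ, E) (fun x => (γ t)⁻¹ * x) (γ t * 1)
        (mfderiv 𝓘(ℝ, E) 𝓘(ℝ, E) (fun x => (γ t)⁻¹ * x) (γ t * 1)) :=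
      (mdifferentiable_mul_left (E := E) (γ t)⁻¹ (γ t * 1)).hasMFDerivAt
    have h3 := h2.comp (1 : G) (hasMFDerivAt_tangentLeft (γ t))
    have h4 : (fun x => (γ t)⁻¹ * x) ∘ (fun x => γ t * x) = (id : G → G) := by
      funext x; simp
    rw [h4, mul_one] at h3
    have h5 := hasMFDerivAt_unique h3 (hasMFDerivAt_id (1 : G))
    have h6 : HasMFDerivWithinAt 𝓘(ℝ, ℝ) 𝓘(ℝ, E) (fun r => (γ t)⁻¹ * γ r) s t
        (ContinuousLinearMap.toSpanSingleton ℝ ξ) := by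
      have h7 : (mfderiv 𝓘(ℝ, E) 𝓘(ℝ, E) (fun x => (γ t)⁻¹ * x) (γ t) : E →L[ℝ] E)
        (tangentLeft (E := E) (γ t) ξ) = ξ := congrArg (fun A : E →L[ℝ] E => A ξ) h5
      have h8 : (mfderiv 𝓘(ℝ, E) 𝓘(ℝ, E) (fun x => (γ t)⁻¹ * x) (γ t) : E →L[ℝ] E).comp
          (ContinuousLinearMap.toSpanSingleton ℝ (tangentLeft (E := E) (γ t) ξ : E)) =
          ContinuousLinearMap.toSpanSingleton ℝ ξ :=
        (clm_comp_toSpanSingleton (E := E) (F := E) (mfderiv 𝓘(ℝ, E) 𝓘(ℝ, E) (fun x => (γ t)⁻¹ * x) (γ t) : E →L[ℝ] E)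
          _).trans (congrArg (ContinuousLinearMap.toSpanSingleton ℝ) h7)
      exact (congrArg (fun A : ℝ →L[ℝ] E =>
        HasMFDerivWithinAt 𝓘(ℝ, ℝ) 𝓘(ℝ, E) (fun r => (γ t)⁻¹ * γ r) s t A) h8).mp h1
    exact hasDerivWithinAt_coord_of_hasMFDerivWithinAt h6 (inv_mul_cancel _)
  · intro h
    have h1 : HasMFDerivWithinAt 𝓘(ℝ, ℝ) 𝓘(ℝ, E) (fun r => (γ t)⁻¹ * γ r) s t
        (ContinuousLinearMap.toSpanSingleton ℝ ξ) :=
      hasMFDerivWithinAt_of_hasDerivWithinAt_coord (h.1.const_mul _) h.2 (inv_mul_cancel _)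
    have h2 : HasMFDerivAt 𝓘(ℝ, E) 𝓘(ℝ, E) (fun x : G => γ t * x) ((γ t)⁻¹ * γ t)
        (tangentLeft (E := E) (γ t) : E →L[ℝ] E) := by
      rw [inv_mul_cancel]
      exact hasMFDerivAt_tangentLeft (γ t)
    have h3 := h2.comp_hasMFDerivWithinAt t h1
    have h4 : (fun x => γ t * x) ∘ (fun r => (γ t)⁻¹ * γ r) = γ := by
      funext x; simp
    rw [h4] at h3
    have h5 : (tangentLeft (E := E) (γ t) : E →L[ℝ] E).comp
        (ContinuousLinearMap.toSpanSingleton ℝ ξ) =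
        ContinuousLinearMap.toSpanSingleton ℝ ((tangentLeft (E := E) (γ t) : E →L[ℝ] E) ξ) :=
      clm_comp_toSpanSingleton (E := E) (F := E) (tangentLeft (E := E) (γ t) : E →L[ℝ] E) ξ
    exact (congrArg (fun A : ℝ →L[ℝ] E => HasMFDerivWithinAt 𝓘(ℝ, ℝ) 𝓘(ℝ, E) γ s t A) h5).mp h3

theorem mfderiv_coord_one :
    HasMFDerivAt 𝓘(ℝ, E) 𝓘(ℝ, E) (coord E) (1 : G) (ContinuousLinearMap.id ℝ E) := by
  refine ⟨continuousAt_coord, ?_⟩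
  suffices h : HasFDerivWithinAt (fun y : E => coord E (point G y)) (ContinuousLinearMap.id ℝ E)
      (range 𝓘(ℝ, E)) (origin E G) from h
  rw [ModelWithCorners.range_eq_univ, hasFDerivWithinAt_univ]
  refine (hasFDerivAt_id _).congr_of_eventuallyEq ?_
  filter_upwards [eventually_coord_point (E := E) (G := G)] with y hy
  exact hy

/-- Near the identity, left translation by `point G y` is `point G` after `coordMul G (y, ·)` after
`coord E`. Taking differentials, the inverse chart's differential carries `leftFrame G y v` to the
left-invariant field, and pulling back inverts that differential. -/
theorem eventually_pullback_mulInvariantVectorField (v : E) : ∀ᶠ y in 𝓝 (origin E G),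
    VectorField.mpullbackWithin 𝓘(ℝ, E) 𝓘(ℝ, E) (extChartAt 𝓘(ℝ, E) (1 : G)).symm
      (mulInvariantVectorField (I := 𝓘(ℝ, E)) (G := G) v) (range 𝓘(ℝ, E)) y = leftFrame G y v := by
  have h2 := eventually_point_coordMul (E := E) (G := G)
  rw [nhds_prod_eq] at h2
  have hp : ContMDiffAt 𝓘(ℝ, E) 𝓘(ℝ, E) 1 (point (E := E) G) (origin E G) :=
    contMDiffAt_point.of_le ENat.LEInfty.out
  filter_upwards [target_mem_nhds_origin (E := E) (G := G), h2.curry,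
    (tendsto_prodMk_origin (E := E) (G := G)).eventually eventually_differentiableAt_coordMul,
    eventually_coordMul_right, (contMDiffAt_iff_contMDiffAt_nhds (by simp)).1 hp]
    with y hy hm hd hr hpy
  have hpd : MDifferentiableAt 𝓘(ℝ, E) 𝓘(ℝ, E) (point (E := E) G) y :=
    hpy.mdifferentiableAt (by simp)
  have hL : HasFDerivAt (fun z => coordMul G (y, z)) (leftFrame G y) (origin E G) := by
    have : DifferentiableAt ℝ (fun z => coordMul G (y, z)) (origin E G) :=
      (HasFDerivAt.comp (g := coordMul G) (f := fun e => (y, e)) (origin E G) hd.hasFDerivAt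
        (hasFDerivAt_prodMk_right y (origin E G))).differentiableAt
    exact this.hasFDerivAt
  have h3 : HasMFDerivAt 𝓘(ℝ, E) 𝓘(ℝ, E) (fun g : G => coordMul G (y, coord E g)) 1
      (leftFrame G y : E →L[ℝ] E) :=
    HasMFDerivAt.comp (I' := 𝓘(ℝ, E)) (g := fun z : E => coordMul G (y, z)) (1 : G)
      hL.hasMFDerivAt mfderiv_coord_one
  have h4 : HasMFDerivAt 𝓘(ℝ, E) 𝓘(ℝ, E) (point (E := E) G) (coordMul G (y, coord E (1 : G)))
      (mfderiv 𝓘(ℝ, E) 𝓘(ℝ, E) (point (E := E) G) y) := by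
    rw [coord_one, hr]
    exact hpd.hasMFDerivAt
  have h5 := h4.comp (1 : G) h3
  have hT : Tendsto (coord E) (𝓝 (1 : G)) (𝓝 (origin E G)) := continuousAt_coord
  have h6 := (hasMFDerivAt_tangentLeft (E := E) (point G y)).congr_of_eventuallyEq
    (f₁ := point G ∘ fun g : G => coordMul G (y, coord E g)) (by
      filter_upwards [hT.eventually hm, eventually_point_coord (E := E) (G := G)] with g hg hg'
      simp only [Function.comp_apply]
      rw [hg, hg'])
  have h7 := hasMFDerivAt_unique h5 h6
  have hinv := isInvertible_mfderivWithin_extChartAt_symm (I := 𝓘(ℝ, E)) hy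
  rw [VectorField.mpullbackWithin_apply]
  have h8 : mulInvariantVectorField (I := 𝓘(ℝ, E)) (G := G) v
      ((extChartAt 𝓘(ℝ, E) (1 : G)).symm y) =
      mfderivWithin 𝓘(ℝ, E) 𝓘(ℝ, E) (extChartAt 𝓘(ℝ, E) (1 : G)).symm (range 𝓘(ℝ, E)) y
        (leftFrame G y v) := by
    rw [ModelWithCorners.range_eq_univ, mfderivWithin_univ]
    exact (congrArg (fun A : E →L[ℝ] E => A v) h7).symm
  rw [h8]
  exact hinv.inverse_apply_eq.2 rfl

theorem fderiv_sub_fderiv_eq_coordBracket {V W : E → E} {v w : E}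
    (hv : ∀ᶠ y in 𝓝 (origin E G), V y = leftFrame G y v)
    (hw : ∀ᶠ y in 𝓝 (origin E G), W y = leftFrame G y w) :
    fderiv ℝ W (origin E G) (V (origin E G)) - fderiv ℝ V (origin E G) (W (origin E G)) =
      coordBracket G v w := by
  have hL := (contDiffAt_leftFrame (E := E) (G := G)).differentiableAt (by simp) |>.hasFDerivAt
  have hLv := (hL.clm_apply (hasFDerivAt_const v (origin E G))).congr_of_eventuallyEq hv
  have hLw := (hL.clm_apply (hasFDerivAt_const w (origin E G))).congr_of_eventuallyEq hw
  rw [hLv.fderiv, hLw.fderiv, hv.self_of_nhds, hw.self_of_nhds]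
  simp [leftFrame_origin, coordBracket]

/-- The manifold bracket is the vector space bracket of the fields read in the chart. These are y ↦
`leftFrame G y v` and y ↦ `leftFrame G y w`, and the chart has identity differential at the
identity. -/
theorem bracket_eq [CompleteSpace E] (v w : Alg E G) :
    (⁅v, w⁆ : Alg E G) = (coordBracket (E := E) G v w : E) := by
  rw [GroupLieAlgebra.bracket_def, ← VectorField.mlieBracketWithin_univ,
    VectorField.mlieBracketWithin_apply]
  have h1 : mfderiv 𝓘(ℝ, E) 𝓘(ℝ, E) (extChartAt 𝓘(ℝ, E) (1 : G)) 1 = ContinuousLinearMap.id ℝ E :=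
    (mfderiv_coord_one (E := E) (G := G)).mfderiv
  have hv := eventually_pullback_mulInvariantVectorField (E := E) (G := G) v
  have hw := eventually_pullback_mulInvariantVectorField (E := E) (G := G) w
  set V : E → E := VectorField.mpullbackWithin 𝓘(ℝ, E) 𝓘(ℝ, E) (extChartAt 𝓘(ℝ, E) (1 : G)).symm
      (mulInvariantVectorField (I := 𝓘(ℝ, E)) (G := G) v) (range 𝓘(ℝ, E)) with hV
  set W : E → E := VectorField.mpullbackWithin 𝓘(ℝ, E) 𝓘(ℝ, E) (extChartAt 𝓘(ℝ, E) (1 : G)).symm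
      (mulInvariantVectorField (I := 𝓘(ℝ, E)) (G := G) w) (range 𝓘(ℝ, E)) with hW
  have h2 : (VectorField.lieBracketWithin ℝ V W
      ((extChartAt 𝓘(ℝ, E) (1 : G)).symm ⁻¹' univ ∩ range 𝓘(ℝ, E)) (origin E G) : E) =
      coordBracket (E := E) G v w := by
    rw [preimage_univ, univ_inter, ModelWithCorners.range_eq_univ,
      VectorField.lieBracketWithin_eq, fderivWithin_univ, fderivWithin_univ]
    exact fderiv_sub_fderiv_eq_coordBracket (G := G) hv hw
  have h3 : (ContinuousLinearMap.id ℝ E).inverse (coordBracket (E := E) G v w) =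
      coordBracket (E := E) G v w := by simp
  rw [← h2] at h3
  refine Eq.trans ?_ (h3.trans h2)
  exact congrArg (fun A : E →L[ℝ] E => A.inverse (VectorField.lieBracketWithin ℝ V W
      ((extChartAt 𝓘(ℝ, E) (1 : G)).symm ⁻¹' univ ∩ range 𝓘(ℝ, E)) (origin E G))) h1

end Bridge

/-! ### Two analytic tools: Barbalat's lemma and coercivity in finite dimension -/

/-- A form of Barbalat's lemma: if a function converges and its second derivative is bounded, then
its derivative tends to zero. -/
theorem tendsto_deriv_zero_of_bounded_second_deriv {F : Type*} [NormedAddCommGroup F]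
    [NormedSpace ℝ F] {f f' f'' : ℝ → F} {C : ℝ} {l : F}
    (hf : ∀ t, 0 ≤ t → HasDerivWithinAt f (f' t) (Ici 0) t)
    (hf' : ∀ t, 0 ≤ t → HasDerivWithinAt f' (f'' t) (Ici 0) t)
    (hC : ∀ t, 0 ≤ t → ‖f'' t‖ ≤ C) (hl : Tendsto f atTop (𝓝 l)) :
    Tendsto f' atTop (𝓝 0) := by
  have hC0 : 0 ≤ C := (norm_nonneg _).trans (hC 0 le_rfl)
  have hlip : ∀ x ∈ Ici (0 : ℝ), ∀ y ∈ Ici (0 : ℝ), ‖f' y - f' x‖ ≤ C * ‖y - x‖ := by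
    intro x hx y hy
    exact (convex_Ici (0 : ℝ)).norm_image_sub_le_of_norm_hasDerivWithin_le
      (fun t ht => hf' t ht) (fun t ht => hC t ht) hx hy
  -- On [t, t + s] the derivative f' varies by at most C s, so s f'(t) differs from f(t + s) - f(t)
  -- by at most C s².
  have hest : ∀ s, 0 < s → ∀ t, 0 ≤ t → s * ‖f' t‖ ≤ C * s * s + ‖f (t + s) - f t‖ := by
    intro s hs t ht
    have h1 : ∀ r ∈ Icc t (t + s),
        HasDerivWithinAt (fun r => f r - r • f' t) (f' r - f' t) (Icc t (t + s)) r := by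
      intro r hr
      have h2 := (hf r (ht.trans hr.1)).mono
        (fun x hx => ht.trans hx.1 : Icc t (t + s) ⊆ Ici 0)
      have h3 := ((hasDerivWithinAt_id r (Icc t (t + s))).smul_const (f' t))
      rw [one_smul] at h3
      exact h2.sub h3
    have h4 := (convex_Icc t (t + s)).norm_image_sub_le_of_norm_hasDerivWithin_le h1
      (C := C * s) (fun r hr => by
        refine (hlip t ht r (ht.trans hr.1)).trans ?_
        rw [Real.norm_of_nonneg (by linarith [hr.1])]
        exact mul_le_mul_of_nonneg_left (by linarith [hr.2]) hC0)
      (left_mem_Icc.2 (by linarith)) (right_mem_Icc.2 (by linarith))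
    rw [add_sub_cancel_left, Real.norm_of_nonneg hs.le] at h4
    have h5 : s • f' t = (f (t + s) - f t) -
        (f (t + s) - (t + s) • f' t - (f t - t • f' t)) := by
      rw [add_smul]; abel
    calc s * ‖f' t‖ = ‖s • f' t‖ := by rw [norm_smul, Real.norm_of_nonneg hs.le]
      _ ≤ ‖f (t + s) - f t‖ + ‖f (t + s) - (t + s) • f' t - (f t - t • f' t)‖ := by
        rw [h5]; exact norm_sub_le _ _
      _ ≤ C * s * s + ‖f (t + s) - f t‖ := by linarith
  rw [Metric.tendsto_atTop]
  intro ε hε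
  -- The window length makes C s < ε/2, which uses half of ε; convergence of f supplies the other
  -- half. The summand 1 covers C = 0.
  set s : ℝ := ε / (2 * (C + 1)) with hs
  have hs0 : 0 < s := by positivity
  have hCs : C * s < ε / 2 := by
    rw [hs, mul_div_assoc', div_lt_div_iff₀ (by positivity) (by positivity)]
    nlinarith
  have hd : Tendsto (fun t => f (t + s) - f t) atTop (𝓝 0) := by
    have := (hl.comp (tendsto_atTop_add_const_right atTop s tendsto_id)).sub hl
    simpa using this
  rw [Metric.tendsto_atTop] at hd
  obtain ⟨T, hT⟩ := hd (s * (ε / 2)) (by positivity)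
  refine ⟨max T 0, fun t ht => ?_⟩
  have h1 := hT t ((le_max_left _ _).trans ht)
  have h2 := hest s hs0 t ((le_max_right _ _).trans ht)
  rw [dist_zero_right] at h1 ⊢
  have h3 : s * ‖f' t‖ < s * ε := by nlinarith
  exact lt_of_mul_lt_mul_left h3 hs0.le

theorem exists_coercive_of_pos {E : Type*} [NormedAddCommGroup E] [NormedSpace ℝ E]
    [FiniteDimensional ℝ E] (B : E →L[ℝ] E →L[ℝ] ℝ) (hB : ∀ v, v ≠ 0 → 0 < B v v) :
    ∃ c : ℝ, 0 < c ∧ ∀ v, c * ‖v‖ ^ 2 ≤ B v v := by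
  have hcont : Continuous fun v : E => B v v := by fun_prop
  have : ProperSpace E := FiniteDimensional.proper_real E
  obtain ⟨c, hc, hmin⟩ : ∃ c : ℝ, 0 < c ∧ ∀ v ∈ Metric.sphere (0 : E) 1, c ≤ B v v := by
    -- The unit sphere is empty when E is trivial; any constant then works.
    rcases (Metric.sphere (0 : E) 1).eq_empty_or_nonempty with h | h
    · exact ⟨1, one_pos, by simp [h]⟩
    · obtain ⟨v, hv, hm⟩ := (isCompact_sphere (0 : E) 1).exists_isMinOn h hcont.continuousOn
      exact ⟨B v v, hB v (by rintro rfl; simp at hv), fun w hw => hm hw⟩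
  refine ⟨c, hc, fun v => ?_⟩
  by_cases hv : v = 0
  · simp [hv]
  have hn : 0 < ‖v‖ := norm_pos_iff.2 hv
  have h1 := hmin (‖v‖⁻¹ • v) (by simp [norm_smul, hn.ne'])
  simp only [map_smul, _root_.smul_apply, smul_eq_mul] at h1
  have h2 : B v v = ‖v‖ ^ 2 * (‖v‖⁻¹ * (‖v‖⁻¹ * B v v)) := by field_simp
  rw [h2, mul_comm]
  exact mul_le_mul_of_nonneg_left h1 (by positivity)

/-! ### The autonomous error system: energy, convergence, stability -/

section ErrorSystem

variable (E : Type*) [NormedAddCommGroup E] [NormedSpace ℝ E]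
variable (G : Type*) [TopologicalSpace G] [ChartedSpace E G] [Group G]

/-- The autonomous system `h' = T_e L_h (σ - K X(h))`, `α σ' = - K X(h) - ρ σ` governing the tracking
error, where `X` is the gradient of `Ψ` with respect to the inner product `J`. -/
structure ErrorSystem where
  Ψ : G → ℝ
  X : G → E
  J : E →L[ℝ] E →L[ℝ] ℝ
  ρ : E →L[ℝ] E
  K : ℝ
  α : ℝ
  smooth : LeftSmooth E Ψ
  nonneg : ∀ g, 0 ≤ Ψ g
  proper : IsProperMap Ψ
  map_one : Ψ 1 = 0
  smooth_grad : LeftSmooth E X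
  grad : ∀ g v, J (X g) v = leftDeriv E Ψ g v
  nondegenerate : ∀ v, leftDeriv E X 1 v = 0 → v = 0
  symm : ∀ v w, J v w = J w v
  coercive : ∃ c : ℝ, 0 < c ∧ ∀ v, c * ‖v‖ ^ 2 ≤ J v v
  dissipative : ∀ v, 0 ≤ J (ρ v) v
  K_pos : 0 < K
  α_pos : 0 < α

variable {E G}

namespace ErrorSystem

variable (S : ErrorSystem E G)

/-- The relative body velocity. -/
def vel (x : G × E) : E := x.2 - S.K • S.X x.1

/-- The derivative of the second component of the state. -/
def acc (x : G × E) : E := -((1 / S.α) • (S.K • S.X x.1 + S.ρ x.2))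

/-- The energy of the error system. -/
def energy (x : G × E) : ℝ := S.K * S.Ψ x.1 + S.α / 2 * S.J x.2 x.2

/-- The curve `x` satisfies the equations of the error system at time `t`, within `s`. -/
structure SolvesWithinAt (x : ℝ → G × E) (s : Set ℝ) (t : ℝ) : Prop where
  fst : HasBodyVelocityWithinAt (fun r => (x r).1) (S.vel (x t)) s t
  snd : HasDerivWithinAt (fun r => (x r).2) (S.acc (x t)) s t

variable [LieGroup 𝓘(ℝ, E) ∞ G]
variable {S} {x : ℝ → G × E}

theorem inner_self_nonneg (v : E) : 0 ≤ S.J v v := by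
  obtain ⟨c, hc, h⟩ := S.coercive
  exact le_trans (by positivity) (h v)

/-- The potential contributes K J(X, σ) and the quadratic term -K J(X, σ); these cancel, and only
the two dissipative terms remain. -/
theorem SolvesWithinAt.hasDerivWithinAt_energy {s : Set ℝ} {t : ℝ} (h : S.SolvesWithinAt x s t) :
    HasDerivWithinAt (fun r => S.energy (x r))
      (-(S.K ^ 2 * S.J (S.X (x t).1) (S.X (x t).1)) - S.J (S.ρ (x t).2) (x t).2) s t := by
  have h1 := (h.fst.hasDerivWithinAt_comp S.smooth).const_mul S.K
  have h2 := (S.J.hasFDerivAt.comp_hasDerivWithinAt t h.snd).clm_apply h.snd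
  have h3 := h1.add (h2.const_mul (S.α / 2))
  refine h3.congr_deriv ?_
  have hα := S.α_pos.ne'
  rw [← S.grad]
  simp only [vel, acc, map_sub, map_smul, map_neg, map_add, _root_.smul_apply, _root_.neg_apply,
    _root_.add_apply, smul_eq_mul, Function.comp_apply]
  rw [S.symm (x t).2 (S.X (x t).1), S.symm (x t).2 (S.ρ (x t).2)]
  field_simp
  ring

theorem dissipation_nonpos (x : G × E) :
    -(S.K ^ 2 * S.J (S.X x.1) (S.X x.1)) - S.J (S.ρ x.2) x.2 ≤ 0 := by
  have h1 := inner_self_nonneg (S := S) (S.X x.1)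
  have h2 := S.dissipative x.2
  have h3 := mul_nonneg (sq_nonneg S.K) h1
  linarith

theorem antitoneOn_energy {s : Set ℝ} (hs : Convex ℝ s) (h : ∀ t ∈ s, S.SolvesWithinAt x s t) :
    AntitoneOn (fun t => S.energy (x t)) s := by
  refine antitoneOn_of_hasDerivWithinAt_nonpos hs
    (fun t ht => (h t ht).hasDerivWithinAt_energy.continuousWithinAt)
    (fun t ht => (h t (interior_subset ht)).hasDerivWithinAt_energy.mono interior_subset)
    (fun t _ => dissipation_nonpos _)

theorem energy_nonneg (x : G × E) : 0 ≤ S.energy x :=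
  add_nonneg (mul_nonneg S.K_pos.le (S.nonneg _))
    (mul_nonneg (by linarith [S.α_pos]) (inner_self_nonneg _))

theorem mul_le_energy (x : G × E) : S.K * S.Ψ x.1 ≤ S.energy x := by
  have := mul_nonneg (by linarith [S.α_pos] : 0 ≤ S.α / 2) (inner_self_nonneg (S := S) x.2)
  rw [energy]; linarith

theorem exists_sq_norm_le_energy : ∃ c : ℝ, 0 < c ∧ ∀ x : G × E, c * ‖x.2‖ ^ 2 ≤ S.energy x := by
  obtain ⟨c, hc, h⟩ := S.coercive
  refine ⟨S.α / 2 * c, mul_pos (by linarith [S.α_pos]) hc, fun x => ?_⟩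
  have h1 := mul_le_mul_of_nonneg_left (h x.2) (by linarith [S.α_pos] : 0 ≤ S.α / 2)
  have h2 := mul_nonneg S.K_pos.le (S.nonneg x.1)
  rw [energy]; linarith

theorem continuous_energy : Continuous S.energy := by
  have h1 := S.smooth.continuous
  unfold energy
  fun_prop

theorem continuous_vel : Continuous S.vel := by
  have h1 := S.smooth_grad.continuous
  unfold vel
  fun_prop

theorem continuous_acc : Continuous S.acc := by
  have h1 := S.smooth_grad.continuous
  unfold acc
  fun_prop

theorem energy_le (hx : ∀ t, 0 ≤ t → S.SolvesWithinAt x (Ici 0) t) {t : ℝ} (ht : 0 ≤ t) :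
    S.energy (x t) ≤ S.energy (x 0) :=
  antitoneOn_energy (convex_Ici 0) (fun r hr => hx r hr) (mem_Ici.2 le_rfl) ht ht

theorem exists_norm_le_of_energy_le (c : ℝ) : ∃ R, ∀ x : G × E, S.energy x ≤ c → ‖x.2‖ ≤ R := by
  obtain ⟨k, hk, h⟩ := S.exists_sq_norm_le_energy
  refine ⟨Real.sqrt (c / k), fun x hx => Real.le_sqrt_of_sq_le ?_⟩
  rw [le_div_iff₀ hk, mul_comm]
  exact (h x).trans hx

theorem tendsto_energy (hx : ∀ t, 0 ≤ t → S.SolvesWithinAt x (Ici 0) t) :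
    ∃ l, Tendsto (fun t => S.energy (x t)) atTop (𝓝 l) := by
  have ha : Antitone fun t => S.energy (x (max t 0)) := fun s t hst =>
    antitoneOn_energy (convex_Ici 0) (fun r hr => hx r hr) (le_max_right s 0) (le_max_right t 0)
      (max_le_max_right 0 hst)
  refine ⟨_, (tendsto_atTop_ciInf ha ⟨0, ?_⟩).congr' ?_⟩
  · rintro _ ⟨t, rfl⟩; exact energy_nonneg _
  · filter_upwards [eventually_ge_atTop 0] with t ht
    rw [max_eq_left ht]

/-- The form J(ρ σ, σ) may be degenerate, so decay of the energy does not control σ directly.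
Barbalat's lemma is applied to the energy, giving X → 0, and then to X along the solution, giving
DX(h) · vel → 0. Injectivity of DX at the identity recovers vel → 0, and σ = vel + K X. -/
theorem tendsto_of_mem_compact [FiniteDimensional ℝ E]
    (hx : ∀ t, 0 ≤ t → S.SolvesWithinAt x (Ici 0) t) {C : Set G} (hC : IsCompact C)
    (hmem : ∀ t, 0 ≤ t → (x t).1 ∈ C) (hcrit : ∀ g ∈ C, S.X g = 0 → g = 1) :
    Tendsto x atTop (𝓝 (1, 0)) := by
  have hproper : ProperSpace E := FiniteDimensional.proper_real E
  obtain ⟨R, hR⟩ := S.exists_norm_le_of_energy_le (S.energy (x 0))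
  have hK : IsCompact (C ×ˢ Metric.closedBall (0 : E) R) := hC.prod (isCompact_closedBall 0 R)
  have hxK : ∀ t, 0 ≤ t → x t ∈ C ×ˢ Metric.closedBall (0 : E) R := fun t ht =>
    ⟨hmem t ht, by simpa using hR _ (energy_le hx ht)⟩
  have hbound : ∀ q : G × E → E, Continuous q → ∃ M, ∀ t, 0 ≤ t → ‖q (x t)‖ ≤ M := by
    intro q hq
    obtain ⟨M, hM⟩ := hK.exists_bound_of_continuousOn hq.continuousOn
    exact ⟨M, fun t ht => hM _ (hxK t ht)⟩
  have hXc := S.smooth_grad.continuous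
  have hDc := S.smooth_grad.leftDeriv.continuous
  have hDDc := S.smooth_grad.leftDeriv.leftDeriv.continuous
  have hvc := S.continuous_vel
  have hac := S.continuous_acc
  have hX' : ∀ t, 0 ≤ t → HasDerivWithinAt (fun r => S.X (x r).1)
      (leftDeriv E S.X (x t).1 (S.vel (x t))) (Ici 0) t :=
    fun t ht => (hx t ht).fst.hasDerivWithinAt_comp S.smooth_grad
  have hV'' : ∀ t, 0 ≤ t → HasDerivWithinAt (fun r => -(S.K ^ 2 *
      S.J (S.X (x r).1) (S.X (x r).1)) - S.J (S.ρ (x r).2) (x r).2)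
      (-(S.K ^ 2 * (S.J (leftDeriv E S.X (x t).1 (S.vel (x t))) (S.X (x t).1) +
        S.J (S.X (x t).1) (leftDeriv E S.X (x t).1 (S.vel (x t))))) -
        (S.J (S.ρ (S.acc (x t))) (x t).2 + S.J (S.ρ (x t).2) (S.acc (x t)))) (Ici 0) t := by
    intro t ht
    have h1 := (S.J.hasFDerivAt.comp_hasDerivWithinAt t (hX' t ht)).clm_apply (hX' t ht)
    have h2 := ((S.J.comp S.ρ).hasFDerivAt.comp_hasDerivWithinAt t (hx t ht).snd).clm_apply
      (hx t ht).snd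
    exact ((h1.const_mul (S.K ^ 2)).neg).sub h2
  obtain ⟨M, hM⟩ : ∃ M, ∀ t, 0 ≤ t → ‖-(S.K ^ 2 * (S.J (leftDeriv E S.X (x t).1 (S.vel (x t)))
        (S.X (x t).1) + S.J (S.X (x t).1) (leftDeriv E S.X (x t).1 (S.vel (x t))))) -
        (S.J (S.ρ (S.acc (x t))) (x t).2 + S.J (S.ρ (x t).2) (S.acc (x t)))‖ ≤ M := by
    have hq : Continuous fun z : G × E => -(S.K ^ 2 * (S.J (leftDeriv E S.X z.1 (S.vel z))
        (S.X z.1) + S.J (S.X z.1) (leftDeriv E S.X z.1 (S.vel z)))) -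
        (S.J (S.ρ (S.acc z)) z.2 + S.J (S.ρ z.2) (S.acc z)) := by fun_prop
    obtain ⟨M, hM⟩ := hK.exists_bound_of_continuousOn hq.continuousOn
    exact ⟨M, fun t ht => hM _ (hxK t ht)⟩
  obtain ⟨l, hl⟩ := tendsto_energy hx
  have hV' := tendsto_deriv_zero_of_bounded_second_deriv
    (fun t ht => (hx t ht).hasDerivWithinAt_energy) hV'' hM hl
  have hX0 : Tendsto (fun t => S.X (x t).1) atTop (𝓝 0) := by
    obtain ⟨c, hc, hcoer⟩ := S.coercive
    have hk : 0 < S.K ^ 2 * c := mul_pos (pow_pos S.K_pos 2) hc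
    have h1 : Tendsto (fun t => ‖S.X (x t).1‖ ^ 2) atTop (𝓝 0) := by
      refine squeeze_zero (fun t => by positivity) (fun t => ?_)
        (by simpa using (hV'.neg.const_mul (S.K ^ 2 * c)⁻¹))
      rw [le_inv_mul_iff₀ hk]
      have h2 := mul_le_mul_of_nonneg_left (hcoer (S.X (x t).1)) (sq_nonneg S.K)
      have h3 := S.dissipative (x t).2
      linarith
    have h2 := h1.sqrt
    rw [Real.sqrt_zero] at h2
    rw [tendsto_zero_iff_norm_tendsto_zero]
    simpa using h2
  -- Every cluster point of h in the compact set is a zero of X, hence equals 1; uniqueness of the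
  -- cluster point yields convergence.
  have hg : Tendsto (fun t => (x t).1) atTop (𝓝 1) := by
    refine hC.tendsto_nhds_of_unique_mapClusterPt
      ((eventually_ge_atTop 0).mono fun t ht => hmem t ht) fun g hgC hg => ?_
    have h1 : MapClusterPt (S.X g) atTop (fun t => S.X (x t).1) :=
      hg.continuousAt_comp hXc.continuousAt
    exact hcrit g hgC (eq_of_nhds_neBot (ClusterPt.mono h1 hX0))
  have hv' : ∀ t, 0 ≤ t → HasDerivWithinAt (fun r => S.vel (x r))
      (S.acc (x t) - S.K • leftDeriv E S.X (x t).1 (S.vel (x t))) (Ici 0) t :=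
    fun t ht => (hx t ht).snd.sub ((hX' t ht).const_smul S.K)
  have hX'' : ∀ t, 0 ≤ t → HasDerivWithinAt (fun r => leftDeriv E S.X (x r).1 (S.vel (x r)))
      (leftDeriv E (leftDeriv E S.X) (x t).1 (S.vel (x t)) (S.vel (x t)) +
        leftDeriv E S.X (x t).1
          (S.acc (x t) - S.K • leftDeriv E S.X (x t).1 (S.vel (x t)))) (Ici 0) t :=
    fun t ht => ((hx t ht).fst.hasDerivWithinAt_comp S.smooth_grad.leftDeriv).clm_apply (hv' t ht)
  obtain ⟨M₂, hM₂⟩ := hbound (fun z => leftDeriv E (leftDeriv E S.X) z.1 (S.vel z) (S.vel z) +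
        leftDeriv E S.X z.1 (S.acc z - S.K • leftDeriv E S.X z.1 (S.vel z))) (by fun_prop)
  have hD0 := tendsto_deriv_zero_of_bounded_second_deriv hX' hX'' hM₂ hX0
  obtain ⟨M₃, hM₃⟩ := hbound S.vel hvc
  -- The base point moves from h to its limit 1; the error vanishes because vel is bounded.
  have hD1 : Tendsto (fun t => leftDeriv E S.X 1 (S.vel (x t))) atTop (𝓝 0) := by
    have h1 : Tendsto (fun t => leftDeriv E S.X (x t).1 - leftDeriv E S.X 1) atTop (𝓝 0) := by
      have := (hDc.tendsto 1).comp hg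
      simpa using this.sub_const (leftDeriv E S.X 1)
    have h2 : Tendsto (fun t => (leftDeriv E S.X (x t).1 - leftDeriv E S.X 1) (S.vel (x t)))
        atTop (𝓝 0) := by
      refine squeeze_zero_norm' (a := fun t => ‖leftDeriv E S.X (x t).1 - leftDeriv E S.X 1‖ * M₃)
        ?_ (by simpa using h1.norm.mul_const M₃)
      filter_upwards [eventually_ge_atTop 0] with t ht
      exact (ContinuousLinearMap.le_opNorm _ _).trans
        (mul_le_mul_of_nonneg_left (hM₃ t ht) (norm_nonneg _))
    have h3 := hD0.sub h2
    simpa using h3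
  obtain ⟨c, hc, hanti⟩ := (leftDeriv E S.X (1 : G)).toLinearMap.exists_antilipschitzWith
    (LinearMap.ker_eq_bot'.2 S.nondegenerate)
  have hv0 : Tendsto (fun t => S.vel (x t)) atTop (𝓝 0) := by
    refine squeeze_zero_norm (a := fun t => c * ‖leftDeriv E S.X 1 (S.vel (x t))‖) (fun t => ?_)
      (by simpa using hD1.norm.const_mul (c : ℝ))
    have := hanti.le_mul_dist (S.vel (x t)) 0
    simpa using this
  have hs : Tendsto (fun t => (x t).2) atTop (𝓝 0) := by
    have := hv0.add (hX0.const_smul S.K)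
    simpa [vel] using this
  exact hg.prodMk_nhds hs

/-- A zero of the nonnegative Ψ is a minimum, hence a critical point. -/
theorem grad_eq_zero_of_eq_zero {g : G} (h : S.Ψ g = 0) : S.X g = 0 := by
  have h1 : leftDeriv E S.Ψ g = 0 := by
    refine IsLocalMin.fderiv_eq_zero (Eventually.of_forall fun y => ?_)
    simp only [point_origin, mul_one, h]
    exact S.nonneg _
  obtain ⟨c, hc, hcoer⟩ := S.coercive
  have h2 := hcoer (S.X g)
  rw [S.grad, h1, _root_.zero_apply] at h2
  have h3 : ‖S.X g‖ ^ 2 ≤ 0 := by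
    by_contra h4
    exact absurd (mul_pos hc (not_le.1 h4)) (not_lt.2 h2)
  exact norm_eq_zero.1 (pow_eq_zero_iff two_ne_zero |>.1 (le_antisymm h3 (by positivity)))

/-- A map whose derivative at a point is injective, hence bounded below in finite dimension, has at
most an isolated zero there. -/
theorem eventually_eq_one_of_grad_eq_zero [FiniteDimensional ℝ E] :
    ∀ᶠ g in 𝓝 (1 : G), S.X g = 0 → g = 1 := by
  have h1 : HasFDerivAt (fun y : E => S.X (1 * point G y)) (leftDeriv E S.X 1) (origin E G) :=
    ((S.smooth_grad 1).differentiableAt (by simp)).hasFDerivAt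
  obtain ⟨c, -, hanti⟩ := (leftDeriv E S.X (1 : G)).toLinearMap.exists_antilipschitzWith
    (LinearMap.ker_eq_bot'.2 S.nondegenerate)
  have h2 := h1.eventually_ne (c := 0) ⟨c, hanti⟩
  rw [eventually_nhdsWithin_iff] at h2
  have hT : Tendsto (coord E) (𝓝 (1 : G)) (𝓝 (origin E G)) := continuousAt_coord
  filter_upwards [hT.eventually h2, eventually_point_coord (E := E) (G := G)] with g hg hp hX
  by_contra hne
  refine hg (fun h => hne ?_) ?_
  · rw [← hp, h, point_origin]
  · rw [one_mul, hp, hX]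

/-- Small sublevel sets of the energy around the equilibrium trap the solutions. -/
theorem exists_trapping [T2Space G] [FiniteDimensional ℝ E] {U : Set G} (hU : U ∈ 𝓝 (1 : G))
    {W : Set E} (hW : W ∈ 𝓝 (0 : E)) :
    ∃ N ∈ 𝓝 ((1 : G), (0 : E)), ∀ x : ℝ → G × E, (∀ t, 0 ≤ t → S.SolvesWithinAt x (Ici 0) t) →
      x 0 ∈ N → ∀ t, 0 ≤ t → (x t).1 ∈ U ∧ (x t).2 ∈ W := by
  have : LocallyCompactSpace G := Manifold.locallyCompact_of_finiteDimensional 𝓘(ℝ, E)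
  have hnear : {g : G | S.X g = 0 → g = 1} ∈ 𝓝 (1 : G) := eventually_eq_one_of_grad_eq_zero
  obtain ⟨C, hC1, hCU, hC⟩ := local_compact_nhds (inter_mem hU hnear)
  have hΨc := S.smooth.continuous
  -- A zero of Ψ on the frontier would be a critical point in C, hence the identity, which is
  -- interior to C.
  obtain ⟨c, hc, hfr⟩ : ∃ c : ℝ, 0 < c ∧ ∀ g ∈ frontier C, c ≤ S.Ψ g := by
    have hfc : IsCompact (frontier C) := hC.of_isClosed_subset isClosed_frontier
      hC.isClosed.frontier_subset
    rcases (frontier C).eq_empty_or_nonempty with h | h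
    · exact ⟨1, one_pos, by simp [h]⟩
    · obtain ⟨g, hg, hm⟩ := hfc.exists_isMinOn h hΨc.continuousOn
      refine ⟨S.Ψ g, lt_of_le_of_ne (S.nonneg g) fun h0 => ?_, fun k hk => hm hk⟩
      have h1 : g = 1 := (hCU (hC.isClosed.frontier_subset hg)).2 (grad_eq_zero_of_eq_zero h0.symm)
      rw [h1] at hg
      exact hg.2 (mem_interior_iff_mem_nhds.2 hC1)
  obtain ⟨r, hr, hrW⟩ := Metric.mem_nhds_iff.1 hW
  obtain ⟨k, hk, hcoer⟩ := S.exists_sq_norm_le_energy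
  have hE0 : S.energy ((1 : G), (0 : E)) = 0 := by simp [energy, S.map_one]
  -- Below K c the frontier of C cannot be met; below k r² the second component stays in the ball of
  -- radius r.
  have hN1 : ∀ᶠ z in 𝓝 ((1 : G), (0 : E)), S.energy z < min (S.K * c) (k * r ^ 2) := by
    refine S.continuous_energy.continuousAt.eventually_lt continuousAt_const ?_
    rw [hE0]
    exact lt_min (mul_pos S.K_pos hc) (mul_pos hk (pow_pos hr 2))
  have hN2 : ∀ᶠ z in 𝓝 ((1 : G), (0 : E)), z.1 ∈ C :=
    continuous_fst.continuousAt.eventually hC1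
  refine ⟨_, hN1.and hN2, fun x hx h0 => ?_⟩
  have hlt : ∀ t, 0 ≤ t → S.energy (x t) < min (S.K * c) (k * r ^ 2) :=
    fun t ht => (energy_le hx ht).trans_lt h0.1
  -- A connected path that starts in the interior of C and avoids the frontier cannot leave C.
  have hpre : IsPreconnected ((fun t => (x t).1) '' Ici 0) :=
    isPreconnected_Ici.image _ fun t ht => (hx t ht).fst.1
  have hCmem : ∀ t, 0 ≤ t → (x t).1 ∈ C := by
    intro t ht
    have hfrontier : ∀ s, 0 ≤ s → (x s).1 ∉ frontier C := by
      intro s hs hsf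
      have h1 := (hlt s hs).trans_le (min_le_left _ _)
      have h2 := mul_le_mul_of_nonneg_left (hfr _ hsf) S.K_pos.le
      exact absurd (h2.trans (S.mul_le_energy (x s))) (not_le.2 h1)
    have hint : ∀ s, 0 ≤ s → (x s).1 ∈ C → (x s).1 ∈ interior C := fun s hs hsC => by
      by_contra h
      exact hfrontier s hs ⟨subset_closure hsC, h⟩
    by_contra hnot
    obtain ⟨g, -, hgi, hgc⟩ := hpre (interior C) Cᶜ isOpen_interior hC.isClosed.isOpen_compl
      (by
        rintro _ ⟨s, hs, rfl⟩
        by_cases h : (x s).1 ∈ C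
        · exact Or.inl (hint s hs h)
        · exact Or.inr h)
      ⟨(x 0).1, ⟨0, mem_Ici.2 le_rfl, rfl⟩, hint 0 le_rfl h0.2⟩
      ⟨(x t).1, ⟨t, ht, rfl⟩, hnot⟩
    exact hgc (interior_subset hgi)
  refine fun t ht => ⟨(hCU (hCmem t ht)).1, hrW ?_⟩
  rw [mem_ball_zero_iff]
  have h1 := (hcoer (x t)).trans_lt ((hlt t ht).trans_le (min_le_right _ _))
  exact lt_of_pow_lt_pow_left₀ 2 hr.le (lt_of_mul_lt_mul_left h1 hk.le)

theorem exists_basin [T2Space G] [FiniteDimensional ℝ E] :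
    ∃ N ∈ 𝓝 ((1 : G), (0 : E)), ∀ x : ℝ → G × E, (∀ t, 0 ≤ t → S.SolvesWithinAt x (Ici 0) t) →
      x 0 ∈ N → Tendsto x atTop (𝓝 (1, 0)) := by
  have : LocallyCompactSpace G := Manifold.locallyCompact_of_finiteDimensional 𝓘(ℝ, E)
  have hnear : {g : G | S.X g = 0 → g = 1} ∈ 𝓝 (1 : G) := eventually_eq_one_of_grad_eq_zero
  obtain ⟨C, hC1, hCU, hC⟩ := local_compact_nhds hnear
  obtain ⟨N, hN, h⟩ := S.exists_trapping hC1 univ_mem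
  exact ⟨N, hN, fun x hx h0 => tendsto_of_mem_compact hx hC (fun t ht => (h x hx h0 t ht).1)
    fun g hg => hCU hg⟩

/-- The energy bound confines h to a sublevel set of Ψ, which is compact by properness. -/
theorem tendsto_of_energy_lt [FiniteDimensional ℝ E]
    (hx : ∀ t, 0 ≤ t → S.SolvesWithinAt x (Ici 0) t) {L : ℝ} (hL : S.energy (x 0) ≤ S.K * L)
    (hcrit : ∀ g, S.Ψ g ≤ L → S.X g = 0 → g = 1) :
    Tendsto x atTop (𝓝 (1, 0)) := by
  have hC : IsCompact (S.Ψ ⁻¹' Icc 0 L) := S.proper.isCompact_preimage isCompact_Icc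
  refine tendsto_of_mem_compact hx hC (fun t ht => ⟨S.nonneg _, ?_⟩) fun g hg => hcrit g hg.2
  exact le_of_mul_le_mul_left ((S.mul_le_energy (x t)).trans ((energy_le hx ht).trans hL)) S.K_pos

end ErrorSystem

end ErrorSystem

/-! ### Global existence for the error system -/

section Existence

variable {E : Type*} [NormedAddCommGroup E] [NormedSpace ℝ E]
variable {G : Type*} [TopologicalSpace G] [ChartedSpace E G] [Group G]
variable [LieGroup 𝓘(ℝ, E) ∞ G]

/-- The ODE is solved in coordinates as y' = `leftFrame G y` ξ. The left inverse B, obtained by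
differentiating y⁻¹ (y z) = z, turns y' back into the body velocity ξ. -/
theorem eventually_exists_inverse_leftFrame : ∀ᶠ y in 𝓝 (origin E G),
    ContinuousAt (point G) y ∧ ∃ B : E →L[ℝ] E,
      HasFDerivAt (fun z => coord E ((point G y)⁻¹ * point G z)) B y ∧
      ∀ v, B (leftFrame G y v) = v := by
  have hq : ContDiffAt ℝ ∞ (fun p : E × E => coord E ((point G p.1)⁻¹ * point G p.2))
      (origin E G, origin E G) :=
    contDiffAt_coord_comp (a := fun p : E × E => (point G p.1)⁻¹ * point G p.2)
      ((contMDiffAt_point_comp contDiffAt_fst rfl).inv.mul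
        (contMDiffAt_point_comp contDiffAt_snd rfl)) (by simp)
  have hq1 : ContDiffAt ℝ 1 (fun p : E × E => coord E ((point G p.1)⁻¹ * point G p.2))
      (origin E G, origin E G) := hq.of_le ENat.LEInfty.out
  have hdiag : Tendsto (fun y : E => (y, y)) (𝓝 (origin E G)) (𝓝 (origin E G, origin E G)) :=
    (continuous_id.prodMk continuous_id).tendsto _
  have hmul := eventually_point_coordMul (E := E) (G := G)
  have hcp : ∀ᶠ p : E × E in 𝓝 (origin E G, origin E G), coord E (point G p.2) = p.2 :=
    (continuous_snd.tendsto (origin E G, origin E G)).eventually eventually_coord_point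
  have hboth := hmul.and hcp
  rw [nhds_prod_eq] at hboth
  have hp : ContMDiffAt 𝓘(ℝ, E) 𝓘(ℝ, E) 1 (point (E := E) G) (origin E G) :=
    contMDiffAt_point.of_le ENat.LEInfty.out
  filter_upwards [hboth.curry, hdiag.eventually (hq1.eventually (by simp)),
    (tendsto_prodMk_origin (E := E) (G := G)).eventually eventually_differentiableAt_coordMul,
    eventually_coordMul_right, (contMDiffAt_iff_contMDiffAt_nhds (by simp)).1 hp]
    with y hy hd hm hr hpy
  refine ⟨hpy.continuousAt, ?_⟩
  have h1 : DifferentiableAt ℝ (fun z => coord E ((point G y)⁻¹ * point G z)) y :=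
    (HasFDerivAt.comp (g := fun p : E × E => coord E ((point G p.1)⁻¹ * point G p.2))
      (f := fun e => (y, e)) y (hd.differentiableAt (by simp)).hasFDerivAt
      (hasFDerivAt_prodMk_right y y)).differentiableAt
  refine ⟨_, h1.hasFDerivAt, fun v => ?_⟩
  have hL : HasFDerivAt (fun z => coordMul G (y, z)) (leftFrame G y) (origin E G) := by
    have : DifferentiableAt ℝ (fun z => coordMul G (y, z)) (origin E G) :=
      (HasFDerivAt.comp (g := coordMul G) (f := fun e => (y, e)) (origin E G) hm.hasFDerivAt
        (hasFDerivAt_prodMk_right y (origin E G))).differentiableAt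
    exact this.hasFDerivAt
  have h2 : HasFDerivAt (fun z => coord E ((point G y)⁻¹ * point G z))
      (fderiv ℝ (fun z => coord E ((point G y)⁻¹ * point G z)) y)
      (coordMul G (y, origin E G)) := by rw [hr]; exact h1.hasFDerivAt
  have h3 := h2.comp (origin E G) hL
  have h4 := (hasFDerivAt_id (𝕜 := ℝ) (origin E G)).congr_of_eventuallyEq
    (f₁ := (fun z => coord E ((point G y)⁻¹ * point G z)) ∘ fun z => coordMul G (y, z)) (by
      filter_upwards [hy] with z hz
      simp only [Function.comp_apply, hz.1, inv_mul_cancel_left, hz.2, id_eq])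
  exact congrArg (fun A : E →L[ℝ] E => A v) (h3.unique h4)

theorem HasBodyVelocityWithinAt.mono {γ : ℝ → G} {ξ : E} {s s' : Set ℝ} {t : ℝ}
    (h : HasBodyVelocityWithinAt γ ξ s t) (hs : s' ⊆ s) : HasBodyVelocityWithinAt γ ξ s' t :=
  ⟨h.1.mono hs, h.2.mono hs⟩

namespace ErrorSystem

variable {S : ErrorSystem E G} {x : ℝ → G × E}

theorem SolvesWithinAt.mono_of_mem_nhdsWithin {s s' : Set ℝ} {t : ℝ} (h : S.SolvesWithinAt x s t)
    (hs : s ∈ 𝓝[s'] t) : S.SolvesWithinAt x s' t :=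
  ⟨⟨h.fst.1.mono_of_mem_nhdsWithin hs, h.fst.2.mono_of_mem_nhdsWithin hs⟩,
    h.snd.mono_of_mem_nhdsWithin hs⟩

theorem SolvesWithinAt.mono {s s' : Set ℝ} {t : ℝ} (h : S.SolvesWithinAt x s t) (hs : s' ⊆ s) :
    S.SolvesWithinAt x s' t :=
  ⟨h.fst.mono hs, h.snd.mono hs⟩

theorem SolvesWithinAt.union {s s' : Set ℝ} {t : ℝ} (h : S.SolvesWithinAt x s t)
    (h' : S.SolvesWithinAt x s' t) : S.SolvesWithinAt x (s ∪ s') t :=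
  ⟨⟨h.fst.1.union h'.fst.1, h.fst.2.union h'.fst.2⟩, h.snd.union h'.snd⟩

theorem SolvesWithinAt.congr {y : ℝ → G × E} {s : Set ℝ} {t : ℝ} (h : S.SolvesWithinAt x s t)
    (hy : ∀ r ∈ s, y r = x r) (ht : t ∈ s) : S.SolvesWithinAt y s t := by
  have hyt := hy t ht
  refine ⟨⟨?_, ?_⟩, ?_⟩
  · exact h.fst.1.congr (fun r hr => by rw [hy r hr]) (by rw [hyt])
  · simp only [hyt]
    exact h.fst.2.congr (fun r hr => by rw [hy r hr]) (by rw [hyt])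
  · rw [hyt]
    exact h.snd.congr (fun r hr => by rw [hy r hr]) (by rw [hyt])

theorem SolvesWithinAt.comp_sub_const {s s' : Set ℝ} {t a : ℝ} (h : S.SolvesWithinAt x s (t - a))
    (hs : MapsTo (fun r => r - a) s' s) : S.SolvesWithinAt (fun r => x (r - a)) s' t := by
  have h1 : HasDerivWithinAt (fun r : ℝ => r - a) 1 s' t := (hasDerivWithinAt_id t s').sub_const a
  refine ⟨⟨?_, ?_⟩, ?_⟩
  · exact ContinuousWithinAt.comp (g := fun r => (x r).1) h.fst.1 h1.continuousWithinAt hs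
  · simpa [Function.comp_def] using HasDerivWithinAt.scomp t h.fst.2 h1 hs
  · simpa [Function.comp_def] using HasDerivWithinAt.scomp t h.snd h1 hs

/-- Picard–Lindelöf in the chart left-translated to z₀. The time ε must serve all nearby initial
points, since it is made uniform over compact sets afterwards. -/
theorem exists_local_solution [CompleteSpace E] (z₀ : G × E) :
    ∃ ε > 0, ∃ U ∈ 𝓝 z₀, ∀ z ∈ U, ∃ x : ℝ → G × E, x 0 = z ∧
      ∀ t ∈ Icc 0 ε, S.SolvesWithinAt x (Icc 0 ε) t := by
  have hG : IsTopologicalGroup G := topologicalGroup_of_lieGroup 𝓘(ℝ, E) ∞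
  let f : E × E → E × E := fun p =>
    (leftFrame G p.1 (S.vel (z₀.1 * point G p.1, p.2)), S.acc (z₀.1 * point G p.1, p.2))
  have hX : ContDiffAt ℝ ∞ (fun p : E × E => S.X (z₀.1 * point G p.1)) (origin E G, z₀.2) :=
    ContDiffAt.comp (g := fun y : E => S.X (z₀.1 * point G y)) (origin E G, z₀.2)
      (S.smooth_grad z₀.1) contDiffAt_fst
  have hfr : ContDiffAt ℝ ∞ (fun p : E × E => leftFrame G p.1) (origin E G, z₀.2) :=
    ContDiffAt.comp (g := leftFrame G) (origin E G, z₀.2) contDiffAt_leftFrame contDiffAt_fst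
  have hf : ContDiffAt ℝ 1 f (origin E G, z₀.2) := by
    have h1 : ContDiffAt ℝ ∞ f (origin E G, z₀.2) := by
      refine ContDiffAt.prodMk (hfr.clm_apply ?_) ?_
      · exact contDiffAt_snd.sub (hX.const_smul S.K)
      · exact (((hX.const_smul S.K).add
          (S.ρ.contDiff.contDiffAt.comp _ contDiffAt_snd)).const_smul (1 / S.α)).neg
    exact h1.of_le ENat.LEInfty.out
  obtain ⟨δ, hδ, a, r, L, k, hr, hpl⟩ := IsPicardLindelof.of_contDiffAt_one hf
  obtain ⟨φ, hφ, hφc⟩ :=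
    (hpl 0).exists_forall_mem_closedBall_eq_hasDerivWithinAt_continuousOn
  have hball : Metric.closedBall (origin E G, z₀.2) r ∈ 𝓝 (origin E G, z₀.2) :=
    Metric.closedBall_mem_nhds _ (by exact_mod_cast hr)
  have hIcc : Icc (0 - δ) (0 + δ) ∈ 𝓝 (0 : ℝ) := Icc_mem_nhds (by linarith) (by linarith)
  have hφ0 : φ ((origin E G, z₀.2), 0) = (origin E G, z₀.2) :=
    (hφ _ (mem_of_mem_nhds hball)).1
  have hcont : ContinuousAt φ ((origin E G, z₀.2), 0) :=
    hφc.continuousAt (prod_mem_nhds hball hIcc)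
  -- Joint continuity of the flow keeps the solutions, for nearby initial values and short times,
  -- where the frame has its left inverse.
  have hgood : ∀ᶠ p : (E × E) × ℝ in 𝓝 ((origin E G, z₀.2), 0),
      ContinuousAt (point G) (φ p).1 ∧ ∃ B : E →L[ℝ] E,
        HasFDerivAt (fun z => coord E ((point G (φ p).1)⁻¹ * point G z)) B (φ p).1 ∧
        ∀ v, B (leftFrame G (φ p).1 v) = v := by
    have h1 : Tendsto (fun p => (φ p).1) (𝓝 ((origin E G, z₀.2), 0)) (𝓝 (origin E G)) := by
      have := hcont.tendsto.fst_nhds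
      rwa [hφ0] at this
    exact h1.eventually eventually_exists_inverse_leftFrame
  rw [nhds_prod_eq] at hgood
  obtain ⟨P, hP, Q, hQ, hPQ⟩ := Filter.mem_prod_iff.1 hgood
  obtain ⟨ε', hε', hQε⟩ := Metric.mem_nhds_iff.1 (inter_mem hQ hIcc)
  have hsub : Icc 0 (ε' / 2) ⊆ Q ∩ Icc (0 - δ) (0 + δ) := fun t ht =>
    hQε (by rw [Metric.mem_ball, dist_zero_right, Real.norm_of_nonneg ht.1]; linarith [ht.2])
  have hshift : Tendsto (fun z : G × E => z₀.1⁻¹ * z.1) (𝓝 z₀) (𝓝 1) := by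
    have : Continuous fun z : G × E => z₀.1⁻¹ * z.1 := by fun_prop
    simpa using this.tendsto z₀
  have hinit : Tendsto (fun z : G × E => (coord E (z₀.1⁻¹ * z.1), z.2)) (𝓝 z₀)
      (𝓝 (origin E G, z₀.2)) :=
    ((continuousAt_coord (E := E)).tendsto.comp hshift).prodMk_nhds continuous_snd.continuousAt
  refine ⟨ε' / 2, by linarith, _, (hinit.eventually hball).and ((hinit.eventually hP).and
    (hshift.eventually (eventually_point_coord (E := E)))), ?_⟩
  rintro z ⟨hzb, hzP, hzp⟩
  set p₀ : E × E := (coord E (z₀.1⁻¹ * z.1), z.2) with hp₀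
  obtain ⟨h0, hder⟩ := hφ p₀ hzb
  refine ⟨fun t => (z₀.1 * point G (φ (p₀, t)).1, (φ (p₀, t)).2), ?_, ?_⟩
  · have h0' : φ (p₀, 0) = p₀ := h0
    simp only [h0']
    ext
    · simp [hp₀, hzp]
    · simp [hp₀]
  · intro t ht
    have hder' := (hder t (hsub ht).2).mono (fun r hr => (hsub hr).2 : Icc 0 (ε' / 2) ⊆ _)
    obtain ⟨hc, B, hB, hinv⟩ : (p₀, t) ∈ {p : (E × E) × ℝ | _} := hPQ ⟨hzP, (hsub ht).1⟩
    have h1 : HasDerivWithinAt (fun r => (φ (p₀, r)).1) (f (φ (p₀, t))).1 (Icc 0 (ε' / 2)) t :=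
      (ContinuousLinearMap.fst ℝ E E).hasFDerivAt.comp_hasDerivWithinAt t hder'
    have h2 : HasDerivWithinAt (fun r => (φ (p₀, r)).2) (f (φ (p₀, t))).2 (Icc 0 (ε' / 2)) t :=
      (ContinuousLinearMap.snd ℝ E E).hasFDerivAt.comp_hasDerivWithinAt t hder'
    refine ⟨⟨?_, ?_⟩, h2⟩
    · exact (ContinuousAt.comp_continuousWithinAt (g := point G)
        (f := fun r => (φ (p₀, r)).1) hc h1.continuousWithinAt).const_mul _
    · have h3 := hB.comp_hasDerivWithinAt t h1
      rw [hinv] at h3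
      refine h3.congr_of_eventuallyEq (Eventually.of_forall fun r => ?_) ?_
      · simp [mul_assoc]
      · simp [mul_assoc]

theorem exists_uniform_local_solution [CompleteSpace E] {C : Set (G × E)} (hC : IsCompact C) :
    ∃ ε > 0, ∀ z ∈ C, ∃ x : ℝ → G × E, x 0 = z ∧
      ∀ t ∈ Icc 0 ε, S.SolvesWithinAt x (Icc 0 ε) t := by
  refine hC.induction_on (p := fun C => ∃ ε > 0, ∀ z ∈ C, ∃ x : ℝ → G × E, x 0 = z ∧
      ∀ t ∈ Icc 0 ε, S.SolvesWithinAt x (Icc 0 ε) t) ⟨1, one_pos, by simp⟩ ?_ ?_ ?_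
  · rintro A B hAB ⟨ε, hε, h⟩
    exact ⟨ε, hε, fun z hz => h z (hAB hz)⟩
  · rintro A B ⟨ε, hε, h⟩ ⟨ε', hε', h'⟩
    refine ⟨min ε ε', lt_min hε hε', fun z hz => ?_⟩
    have hs : Icc 0 (min ε ε') ⊆ Icc 0 ε := Icc_subset_Icc_right (min_le_left _ _)
    have hs' : Icc 0 (min ε ε') ⊆ Icc 0 ε' := Icc_subset_Icc_right (min_le_right _ _)
    rcases hz with hz | hz
    · obtain ⟨x, hx, hsol⟩ := h z hz
      exact ⟨x, hx, fun t ht => (hsol t (hs ht)).mono hs⟩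
    · obtain ⟨x, hx, hsol⟩ := h' z hz
      exact ⟨x, hx, fun t ht => (hsol t (hs' ht)).mono hs'⟩
  · intro z _
    obtain ⟨ε, hε, U, hU, h⟩ := exists_local_solution (S := S) z
    exact ⟨U, mem_nhdsWithin_of_mem_nhds hU, ε, hε, h⟩

/-- Solutions over `[0, ε]` that remain in a set can be concatenated to solutions over `[0, ∞)`. -/
theorem exists_solution_of_forall_Icc {C : Set (G × E)} {ε : ℝ} (hε : 0 < ε)
    (h : ∀ z ∈ C, ∃ x : ℝ → G × E, x 0 = z ∧ x ε ∈ C ∧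
      ∀ t ∈ Icc 0 ε, S.SolvesWithinAt x (Icc 0 ε) t) {z : G × E} (hz : z ∈ C) :
    ∃ x : ℝ → G × E, x 0 = z ∧ ∀ t, 0 ≤ t → S.SolvesWithinAt x (Ici 0) t := by
  choose! c hc0 hcε hc using h
  let Z : ℕ → G × E := fun n => Nat.rec z (fun _ w => c w ε) n
  have hZ0 : Z 0 = z := rfl
  have hZs : ∀ n, Z (n + 1) = c (Z n) ε := fun n => rfl
  have hZC : ∀ n, Z n ∈ C := by
    intro n
    induction n with
    | zero => exact hz
    | succ n ih => rw [hZs]; exact hcε _ ih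
  let x : ℝ → G × E := fun t => c (Z ⌊t / ε⌋₊) (t - ⌊t / ε⌋₊ * ε)
  -- At the right end of a cell the floor is already n + 1; the formula persists because piece n + 1
  -- starts where piece n ends.
  have hxn : ∀ n : ℕ, ∀ t ∈ Icc (n * ε) ((n + 1) * ε), x t = c (Z n) (t - n * ε) := by
    intro n t ht
    rcases ht.2.lt_or_eq with h1 | h1
    · have h2 : ⌊t / ε⌋₊ = n := by
        rw [Nat.floor_eq_iff (div_nonneg ((by positivity : (0 : ℝ) ≤ n * ε).trans ht.1) hε.le)]
        exact ⟨(le_div_iff₀ hε).2 ht.1, (div_lt_iff₀ hε).2 h1⟩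
      simp only [x, h2]
    · have h2 : ⌊t / ε⌋₊ = n + 1 := by
        rw [h1, mul_div_cancel_right₀ _ hε.ne']
        exact_mod_cast Nat.floor_natCast (R := ℝ) (n + 1)
      simp only [x, h2]
      push_cast
      have h3 : ((n : ℝ) + 1) * ε - n * ε = ε := by ring
      rw [h1, sub_self, h3, ← hZs]
      exact hc0 _ (hZC (n + 1))
  have hsol : ∀ n : ℕ, ∀ t ∈ Icc (n * ε) ((n + 1) * ε),
      S.SolvesWithinAt x (Icc (n * ε) ((n + 1) * ε)) t := by
    intro n t ht
    have hmaps : MapsTo (fun r => r - n * ε) (Icc (n * ε) ((n + 1) * ε)) (Icc 0 ε) := fun r hr =>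
      ⟨by linarith [hr.1], by linarith [hr.2]⟩
    exact ((hc _ (hZC n) _ (hmaps ht)).comp_sub_const hmaps).congr (hxn n) ht
  refine ⟨x, ?_, fun t ht => ?_⟩
  · rw [hxn 0 0 (by simp [hε.le])]
    simpa [hZ0] using hc0 _ (hZC 0)
  · obtain ⟨n, hn⟩ : ∃ n : ℕ, n = ⌊t / ε⌋₊ := ⟨_, rfl⟩
    have h1 : n * ε ≤ t := by
      rw [← le_div_iff₀ hε, hn]; exact Nat.floor_le (div_nonneg ht hε.le)
    have h2 : t < (n + 1) * ε := by
      rw [← div_lt_iff₀ hε, hn]; exact Nat.lt_floor_add_one _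
    have hn1 := hsol n t ⟨h1, h2.le⟩
    rcases h1.lt_or_eq with h3 | h3
    · exact hn1.mono_of_mem_nhdsWithin (mem_nhdsWithin_of_mem_nhds (Icc_mem_nhds h3 h2))
    · rcases n with _ | m
      · have h4 : t = 0 := by rw [← h3]; simp
        refine hn1.mono_of_mem_nhdsWithin ?_
        simp only [h4, Nat.cast_zero, zero_mul, zero_add, one_mul]
        exact Icc_mem_nhdsGE hε
      -- At a junction the one-sided solutions from the two adjacent cells are united; both have the
      -- derivative prescribed by the state x t.
      · have h5 : t = (m + 1) * ε := by rw [← h3]; push_cast; ring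
        have h6 := hsol m t ⟨by rw [h5]; nlinarith, h5.le⟩
        refine (h6.union hn1).mono_of_mem_nhdsWithin (mem_nhdsWithin_of_mem_nhds ?_)
        have h7 : Icc (m * ε) ((m + 1 + 1) * ε) ∈ 𝓝 t := by
          refine Icc_mem_nhds ?_ ?_ <;> rw [h5] <;> nlinarith
        refine mem_of_superset h7 fun r hr => ?_
        push_cast
        rcases le_total r ((m + 1) * ε) with h8 | h8
        · exact Or.inl ⟨hr.1, h8⟩
        · exact Or.inr ⟨h8, hr.2⟩

/-- The error system is complete in forward time. -/
theorem exists_solution [FiniteDimensional ℝ E] (z : G × E) :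
    ∃ x : ℝ → G × E, x 0 = z ∧ ∀ t, 0 ≤ t → S.SolvesWithinAt x (Ici 0) t := by
  have hcomplete : CompleteSpace E := FiniteDimensional.complete ℝ E
  have hproper : ProperSpace E := FiniteDimensional.proper_real E
  obtain ⟨R, hR⟩ := S.exists_norm_le_of_energy_le (S.energy z)
  have hC : IsCompact {w : G × E | S.energy w ≤ S.energy z} := by
    have h1 : IsCompact (S.Ψ ⁻¹' Icc 0 (S.energy z / S.K)) :=
      S.proper.isCompact_preimage isCompact_Icc
    refine (h1.prod (isCompact_closedBall (0 : E) R)).of_isClosed_subset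
      (isClosed_le S.continuous_energy continuous_const) fun w hw => ⟨⟨S.nonneg _, ?_⟩, ?_⟩
    · rw [le_div_iff₀ S.K_pos, mul_comm]
      exact (S.mul_le_energy w).trans hw
    · simpa using hR w hw
  obtain ⟨ε, hε, h⟩ := exists_uniform_local_solution (S := S) hC
  refine exists_solution_of_forall_Icc hε (fun w hw => ?_)
    (C := {w | S.energy w ≤ S.energy z})
    (le_refl (S.energy z))
  obtain ⟨x, hx, hsol⟩ := h w hw
  refine ⟨x, hx, ?_, hsol⟩
  -- The energy does not increase, so each piece ends in the same compact sublevel set and the next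
  -- one can start.
  have h1 := antitoneOn_energy (convex_Icc 0 ε) hsol (left_mem_Icc.2 hε.le) (right_mem_Icc.2 hε.le)
    hε.le
  simp only [hx] at h1
  exact h1.trans hw

end ErrorSystem

end Existence

/-! ### Parents, induction and recursion in an out-tree -/

section Parent

variable {ι : Type*} [Fintype ι] {𝒢 : Digraph (Option ι)}

/-- The last edge of a path from the root gives an in-neighbour; the in-degree bound makes it
unique. -/
theorem IsOutTree.exists_parent (h : IsOutTree 𝒢 none) (i : ι) :
    ∃ j, ∀ k, 𝒢.Adj k (some i) ↔ k = j := by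
  obtain ⟨j, hj⟩ : ∃ j, 𝒢.Adj j (some i) := by
    rcases Relation.ReflTransGen.cases_tail (h.reachable (some i)) with h1 | ⟨j, -, hj⟩
    · exact absurd h1 (by simp)
    · exact ⟨j, hj⟩
  refine ⟨j, fun k => ⟨fun hk => ?_, fun hk => hk ▸ hj⟩⟩
  have h1 := h.inDegree_le_one (some i) (by simp)
  exact (Set.ncard_le_one (Set.toFinite _)).1 h1 k hk j hj

/-- The unique in-neighbour of an agent. -/
def IsOutTree.parent (h : IsOutTree 𝒢 none) (i : ι) : Option ι := (h.exists_parent i).choose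

theorem IsOutTree.adj_iff (h : IsOutTree 𝒢 none) (i : ι) (k : Option ι) :
    𝒢.Adj k (some i) ↔ k = h.parent i := (h.exists_parent i).choose_spec k

theorem IsOutTree.adjCoeff_parent (h : IsOutTree 𝒢 none) (i : ι) :
    adjCoeff 𝒢 (some i) (h.parent i) = 1 := by
  rw [adjCoeff, if_pos ((h.adj_iff i _).2 rfl)]

theorem IsOutTree.sum_adjCoeff_smul (h : IsOutTree 𝒢 none) (i : ι) {M : Type*} [AddCommGroup M]
    [Module ℝ M] (f : Option ι → M) :
    ∑ j, adjCoeff 𝒢 (some i) j • f j = f (h.parent i) := by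
  rw [Finset.sum_eq_single (h.parent i), h.adjCoeff_parent, one_smul]
  · intro j _ hj
    rw [adjCoeff, if_neg (fun h1 => hj ((h.adj_iff i j).1 h1)), zero_smul]
  · simp

theorem IsOutTree.inDegree_eq_one (h : IsOutTree 𝒢 none) (i : ι) :
    inDegree 𝒢 (some i) = 1 := by
  have h1 : {j | 𝒢.Adj j (some i)} = {h.parent i} := by
    ext j; exact h.adj_iff i j
  rw [inDegree, h1, Set.ncard_singleton]

theorem IsOutTree.induction (h : IsOutTree 𝒢 none) {P : Option ι → Prop} (h0 : P none)
    (hs : ∀ i, P (h.parent i) → P (some i)) (j : Option ι) : P j := by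
  induction h.reachable j with
  | refl => exact h0
  | @tail a b _ hab ih =>
    rcases b with _ | i
    · exact h0
    · rw [(h.adj_iff i a).1 hab] at ih
      exact hs i ih

/-- Recursion along an out-tree. -/
theorem IsOutTree.exists_rec (h : IsOutTree 𝒢 none) {A : Type*} (a : A) (step : ι → A → A) :
    ∃ f : Option ι → A, f none = a ∧ ∀ i, f (some i) = step i (f (h.parent i)) := by
  -- Accessibility passes from the parent to the child and holds at the root, which no edge enters.
  have hacc : WellFounded 𝒢.Adj := by
    refine ⟨h.induction ⟨_, fun k hk => absurd hk (h.root k)⟩ fun i hi => ⟨_, fun k hk => ?_⟩⟩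
    rw [(h.adj_iff i k).1 hk]
    exact hi
  let F : (j : Option ι) → ((k : Option ι) → 𝒢.Adj k j → A) → A := fun j =>
    match j with
    | none => fun _ => a
    | some i => fun ih => step i (ih (h.parent i) ((h.adj_iff i _).2 rfl))
  exact ⟨hacc.fix F, hacc.fix_eq F none, fun i => hacc.fix_eq F (some i)⟩

end Parent

/-! ### The error system attached to an agent -/

section Network

variable {E : Type*} [NormedAddCommGroup E] [NormedSpace ℝ E] [FiniteDimensional ℝ E]
variable {G : Type*} [TopologicalSpace G] [ChartedSpace E G] [Group G]
variable {ι : Type*}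

namespace Inertia

variable (J : Inertia E G)

theorem flat_sharp (φ : Module.Dual ℝ (Alg E G)) : J.flat (J.sharp φ) = φ :=
  J.flatEquiv.apply_symm_apply φ

theorem sharp_flat (v : Alg E G) : J.sharp (J.flat v) = v :=
  J.flatEquiv.symm_apply_apply v

/-- `𝕀^♯` on continuous linear forms. -/
def sharpCLM : (E →L[ℝ] ℝ) →L[ℝ] E :=
  LinearMap.toContinuousLinearMap
    { toFun := fun φ => (J.sharp (φ.toLinearMap : E →ₗ[ℝ] ℝ) : E)
      map_add' := fun φ ψ => J.sharp.map_add (φ.toLinearMap : E →ₗ[ℝ] ℝ) (ψ.toLinearMap : E →ₗ[ℝ] ℝ)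
      map_smul' := fun c φ => J.sharp.map_smul c (φ.toLinearMap : E →ₗ[ℝ] ℝ) }

/-- `𝕀` as a continuous bilinear form. -/
def formCLM : E →L[ℝ] E →L[ℝ] ℝ :=
  LinearMap.toContinuousLinearMap
    ((LinearMap.toContinuousLinearMap : (E →ₗ[ℝ] ℝ) ≃ₗ[ℝ] (E →L[ℝ] ℝ)).toLinearMap ∘ₗ
      (J.form : E →ₗ[ℝ] E →ₗ[ℝ] ℝ))

theorem formCLM_sharpCLM (φ : E →L[ℝ] ℝ) (v : E) : J.formCLM (J.sharpCLM φ) v = φ v :=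
  congrArg (fun ψ : Module.Dual ℝ (Alg E G) => ψ v) (J.flat_sharp (φ.toLinearMap : E →ₗ[ℝ] ℝ))

end Inertia

/-- In coordinates the trivialized differential is dΨ(x) ∘ `leftFrame G x`. At the identity the
frame is the identity map, and the term containing its derivative is multiplied by dΨ(e) = 0. -/
theorem hessianAtOne_eq [LieGroup 𝓘(ℝ, E) ∞ G] {Ψ : G → ℝ} (hΨ : LeftSmooth E Ψ)
    (h1 : leftDeriv E Ψ 1 = 0) (v : E) :
    hessianAtOne (E := E) Ψ v = leftDeriv E (leftDeriv E Ψ) 1 v v := by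
  let f : E → ℝ := fun y => Ψ (point G y)
  have hf : ContDiffAt ℝ ∞ f (origin E G) := by simpa using hΨ 1
  have hf0 : fderiv ℝ f (origin E G) = 0 := by simpa [leftDeriv] using h1
  have hev : ∀ᶠ x in 𝓝 (origin E G), leftDeriv E Ψ (1 * point G x) =
      (fderiv ℝ f x).comp (leftFrame G x) := by
    have h2 := eventually_point_coordMul (E := E) (G := G)
    rw [nhds_prod_eq] at h2
    have hf1 : ContDiffAt ℝ 1 f (origin E G) := hf.of_le ENat.LEInfty.out
    filter_upwards [h2.curry, (tendsto_prodMk_origin (E := E) (G := G)).eventually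
      eventually_differentiableAt_coordMul, eventually_coordMul_right, hf1.eventually (by simp)]
      with x hx hm hr hfx
    have hL : HasFDerivAt (fun z => coordMul G (x, z)) (leftFrame G x) (origin E G) := by
      have : DifferentiableAt ℝ (fun z => coordMul G (x, z)) (origin E G) :=
        (HasFDerivAt.comp (g := coordMul G) (f := fun e => (x, e)) (origin E G) hm.hasFDerivAt
          (hasFDerivAt_prodMk_right x (origin E G))).differentiableAt
      exact this.hasFDerivAt
    have hfx' : HasFDerivAt f (fderiv ℝ f x) (coordMul G (x, origin E G)) := by
      rw [hr]; exact (hfx.differentiableAt (by simp)).hasFDerivAt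
    refine ((hfx'.comp (origin E G) hL).congr_of_eventuallyEq ?_).fderiv
    filter_upwards [hx] with y hy
    simp [f, hy]
  have hD : ContDiffAt ℝ 1 (fderiv ℝ f) (origin E G) :=
    hf.fderiv_right (m := 1) (n := ∞) (by rw [one_add_one_eq_two]; exact ENat.LEInfty.out)
  have h3 := ((hD.differentiableAt (by simp)).hasFDerivAt.clm_comp
    ((contDiffAt_leftFrame (E := E) (G := G)).differentiableAt (by simp)).hasFDerivAt)
  have h4 : hessianAtOne (E := E) Ψ v = fderiv ℝ (fderiv ℝ f) (origin E G) v v := rfl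
  rw [h4]
  conv_rhs => rw [leftDeriv]
  rw [(h3.congr_of_eventuallyEq hev).fderiv]
  simp [leftFrame_origin, hf0]

variable [LieGroup 𝓘(ℝ, E) ∞ G]

namespace Network

variable {N : Network E G ι}

/-- The error system of the agent `i`. -/
def Admissible.errorSystem (hN : N.Admissible) (i : ι) : ErrorSystem E G where
  Ψ := N.Ψ
  X := fun g => N.inertia.sharpCLM (leftDeriv E N.Ψ g)
  J := N.inertia.formCLM
  ρ := LinearMap.toContinuousLinearMap
    (N.inertia.sharp ∘ₗ (N.Rdiss : Alg E G →ₗ[ℝ] Module.Dual ℝ (Alg E G)) : E →ₗ[ℝ] E)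
  K := N.Kp
  α := N.α i
  smooth := hN.errorFunction.smooth.leftSmooth
  nonneg := hN.errorFunction.nonneg
  proper := hN.errorFunction.proper
  map_one := hN.errorFunction.map_one
  smooth_grad := (hN.errorFunction.smooth.leftSmooth.leftDeriv).clm_comp N.inertia.sharpCLM
  grad := fun g v => N.inertia.formCLM_sharpCLM _ v
  -- DX(1) v is 𝕀^♯ of the Hessian applied to v; if it vanished, the Hessian would vanish on (v, v).
  nondegenerate := by
    intro v hv
    by_contra hne
    have hsm := hN.errorFunction.smooth.leftSmooth
    have h0 : leftDeriv E N.Ψ (1 : G) = 0 := by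
      refine IsLocalMin.fderiv_eq_zero (Eventually.of_forall fun y => ?_)
      simp only [point_origin, mul_one, hN.errorFunction.map_one]
      exact hN.errorFunction.nonneg _
    have h1 := hN.errorFunction.hessian_pos v hne
    rw [hessianAtOne_eq hsm h0] at h1
    have h2 : leftDeriv E (fun g : G => N.inertia.sharpCLM (leftDeriv E N.Ψ g)) 1 =
        N.inertia.sharpCLM.comp (leftDeriv E (leftDeriv E N.Ψ) 1) :=
      (N.inertia.sharpCLM.hasFDerivAt.comp (origin E G)
        ((hsm.leftDeriv 1).differentiableAt (by simp)).hasFDerivAt).fderiv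
    rw [h2] at hv
    have h3 := N.inertia.formCLM_sharpCLM (leftDeriv E (leftDeriv E N.Ψ) 1 v) v
    have hv' : N.inertia.sharpCLM (leftDeriv E (leftDeriv E N.Ψ) 1 v) = 0 := hv
    rw [hv', map_zero] at h3
    exact h1.ne h3
  symm := fun v w => N.inertia.symm v w
  coercive := exists_coercive_of_pos _ fun v hv => N.inertia.pos v hv
  dissipative := by
    intro v
    have h1 : N.inertia.formCLM (N.inertia.sharp (N.Rdiss v)) v = N.Rdiss v v :=
      congrArg (fun ψ : Module.Dual ℝ (Alg E G) => ψ v) (N.inertia.flat_sharp (N.Rdiss v))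
    exact (hN.dissipation v).trans_eq h1.symm
  K_pos := hN.Kp_pos
  α_pos := hN.α_pos i

end Network

end Network

/-! ### From leader and follower to the relative state, and back -/

section Relative

variable {E : Type*} [NormedAddCommGroup E] [NormedSpace ℝ E]
variable {G : Type*} [TopologicalSpace G] [ChartedSpace E G] [Group G] [LieGroup 𝓘(ℝ, E) ∞ G]

theorem coordBracket_sub_self (v w : E) : coordBracket G (v - w) w = coordBracket G v w := by
  simp [coordBracket]

theorem coordBracket_neg_swap (v w : E) : -coordBracket G v w = coordBracket G w v := by
  simp [coordBracket]

namespace ErrorSystem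

variable (S : ErrorSystem E G)

/-- The state of the error system determined by the states `p` of a leader and `q` of a follower. -/
def relative (p q : G × E) : G × E :=
  (p.1⁻¹ * q.1, q.2 - adAct E (p.1⁻¹ * q.1)⁻¹ p.2 + S.K • S.X (p.1⁻¹ * q.1))

/-- The acceleration of the follower under which the relative state solves the error system. -/
theorem hasDerivWithinAt_iff_solvesWithinAt {γ η : ℝ → G} {v w : ℝ → E} {s : Set ℝ} {t : ℝ}
    (hs : UniqueDiffWithinAt ℝ s t) (hγ : HasBodyVelocityWithinAt γ (v t) s t)
    (hη : HasBodyVelocityWithinAt η (w t) s t) (hv : DifferentiableWithinAt ℝ v s t) :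
    HasDerivWithinAt w (S.acc (S.relative (γ t, v t) (η t, w t))
      + (coordBracket G (adAct E ((γ t)⁻¹ * η t)⁻¹ (v t)) (w t)
        + adAct E ((γ t)⁻¹ * η t)⁻¹ (derivWithin v s t))
      - S.K • derivWithin (fun r => S.X ((γ r)⁻¹ * η r)) s t) s t ↔
    S.SolvesWithinAt (fun r => S.relative (γ r, v r) (η r, w r)) s t := by
  have hh := hγ.inv_mul hη
  have hinv : (η t)⁻¹ * γ t = ((γ t)⁻¹ * η t)⁻¹ := by group
  rw [hinv] at hh
  have hA := hh.hasDerivWithinAt_adAct_inv hv.hasDerivWithinAt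
  -- The relative velocity is w - Ad_{h⁻¹} v; bracketing Ad_{h⁻¹} v with itself gives 0, which
  -- leaves [Ad_{h⁻¹} v, w], the controller's term.
  rw [coordBracket_sub_self, sub_eq_add_neg, coordBracket_neg_swap] at hA
  have hX := hh.hasDerivWithinAt_comp S.smooth_grad
  have hX' := hX.derivWithin hs
  rw [hX']
  constructor
  · intro h
    refine ⟨?_, ?_⟩
    · have h1 : S.vel (S.relative (γ t, v t) (η t, w t)) =
          w t - adAct E ((γ t)⁻¹ * η t)⁻¹ (v t) := add_sub_cancel_right _ _
      rw [← h1] at hh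
      exact hh
    · have h1 : HasDerivWithinAt (fun r => (S.relative (γ r, v r) (η r, w r)).2) _ s t :=
        (h.sub hA).add (hX.const_smul S.K)
      refine h1.congr_deriv ?_
      abel
  · intro h
    have h1 := (h.2.add hA).sub (hX.const_smul S.K)
    refine (h1.congr_deriv ?_).congr (fun r _ => ?_) ?_
    · abel
    · simp only [relative, Pi.add_apply, Pi.sub_apply, Pi.smul_apply]
      abel
    · simp only [relative, Pi.add_apply, Pi.sub_apply, Pi.smul_apply]
      abel

/-- Here boundedness of the reference velocity is needed: Ad_{h⁻¹} - id → 0 is applied to v = (v -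
r) + r, where r need not converge. -/
theorem tendsto_adAct_inv_sub {α : Type*} {l : Filter α} {h : α → G} {v : α → E} {r : α → E} {C : ℝ}
    (hh : Tendsto h l (𝓝 1)) (hv : Tendsto (fun a => v a - r a) l (𝓝 0)) (hr : ∀ᶠ a in l, ‖r a‖ ≤ C) :
    Tendsto (fun a => adAct E (h a)⁻¹ (v a) - v a) l (𝓝 0) := by
  have hA : Tendsto (fun a => adAct E (h a)⁻¹ - ContinuousLinearMap.id ℝ E) l (𝓝 0) := by
    have h1 := ((leftSmooth_adAct_inv (E := E) (G := G)).continuous.tendsto 1).comp hh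
    have h2 := h1.sub_const (ContinuousLinearMap.id ℝ E)
    rw [inv_one, adAct_one, sub_self] at h2
    exact h2
  have h1 : Tendsto (fun a => (adAct E (h a)⁻¹ - ContinuousLinearMap.id ℝ E) (v a - r a)) l
      (𝓝 ((0 : E →L[ℝ] E) 0)) :=
    ((isBoundedBilinearMap_apply (𝕜 := ℝ) (E := E) (F := E)).continuous.tendsto (0, 0)).comp
      (hA.prodMk_nhds hv)
  have h2 : Tendsto (fun a => (adAct E (h a)⁻¹ - ContinuousLinearMap.id ℝ E) (r a)) l (𝓝 0) := by
    have h3 : Tendsto (fun a => ‖adAct E (h a)⁻¹ - ContinuousLinearMap.id ℝ E‖ * C) l (𝓝 0) := by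
      simpa using hA.norm.mul_const C
    refine squeeze_zero_norm' ?_ h3
    filter_upwards [hr] with a ha
    exact (ContinuousLinearMap.le_opNorm _ _).trans
      (mul_le_mul_of_nonneg_left ha (norm_nonneg _))
  have h4 := h1.add h2
  simp only [map_zero, add_zero] at h4
  refine h4.congr fun a => ?_
  rw [← map_add, sub_add_cancel]
  rfl

theorem tendsto_X {α : Type*} {l : Filter α} {h : α → G} (hh : Tendsto h l (𝓝 1)) :
    Tendsto (fun a => S.K • S.X (h a)) l (𝓝 0) := by
  have h1 := ((S.smooth_grad.continuous.tendsto 1).comp hh).const_smul S.K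
  rw [S.grad_eq_zero_of_eq_zero S.map_one, smul_zero] at h1
  exact h1

/-- One induction step along the tree, by telescoping: r⁻¹ q = (r⁻¹ p)(p⁻¹ q), and in velocities q -
r = (σ - K X) + (Ad_{h⁻¹} p - p) + (p - r). -/
theorem tendsto_of_tendsto_relative {α : Type*} {l : Filter α} {p q r : α → G × E} {C : ℝ}
    (hr : ∀ᶠ a in l, ‖(r a).2‖ ≤ C)
    (hp1 : Tendsto (fun a => (r a).1⁻¹ * (p a).1) l (𝓝 1))
    (hp2 : Tendsto (fun a => (p a).2 - (r a).2) l (𝓝 0))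
    (h : Tendsto (fun a => S.relative (p a) (q a)) l (𝓝 (1, 0))) :
    Tendsto (fun a => (r a).1⁻¹ * (q a).1) l (𝓝 1) ∧
      Tendsto (fun a => (q a).2 - (r a).2) l (𝓝 0) := by
  have : IsTopologicalGroup G := topologicalGroup_of_lieGroup 𝓘(ℝ, E) ∞
  have h1 : Tendsto (fun a => (p a).1⁻¹ * (q a).1) l (𝓝 1) := (continuous_fst.tendsto _).comp h
  have h2 := (continuous_snd.tendsto _).comp h
  refine ⟨?_, ?_⟩
  · have h3 := hp1.mul h1
    rw [mul_one] at h3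
    exact h3.congr fun a => by group
  · have h3 := ((h2.sub (S.tendsto_X h1)).add (tendsto_adAct_inv_sub h1 hp2 hr)).add hp2
    simp only [sub_zero, add_zero] at h3
    refine h3.congr fun a => ?_
    simp [relative]

theorem tendsto_relative {α : Type*} {l : Filter α} {p q r : α → G × E} {C : ℝ}
    (hr : ∀ᶠ a in l, ‖(r a).2‖ ≤ C)
    (hp1 : Tendsto (fun a => (r a).1⁻¹ * (p a).1) l (𝓝 1))
    (hp2 : Tendsto (fun a => (p a).2 - (r a).2) l (𝓝 0))
    (hq1 : Tendsto (fun a => (r a).1⁻¹ * (q a).1) l (𝓝 1))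
    (hq2 : Tendsto (fun a => (q a).2 - (r a).2) l (𝓝 0)) :
    Tendsto (fun a => S.relative (p a) (q a)) l (𝓝 (1, 0)) := by
  have : IsTopologicalGroup G := topologicalGroup_of_lieGroup 𝓘(ℝ, E) ∞
  have h1 : Tendsto (fun a => (p a).1⁻¹ * (q a).1) l (𝓝 1) := by
    have h := hp1.inv.mul hq1
    rw [inv_one, mul_one] at h
    exact h.congr fun a => by group
  refine h1.prodMk_nhds ?_
  have h3 := ((hq2.sub hp2).sub (tendsto_adAct_inv_sub h1 hp2 hr)).add (S.tendsto_X h1)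
  simp only [sub_zero, add_zero] at h3
  refine h3.congr fun a => ?_
  abel

end ErrorSystem

/-- Converts a convergence statement along a `comap` filter into one neighbourhood valid for all
indices, by intersecting finitely many. -/
theorem exists_mem_nhds_of_mem_comap {X A κ : Type*} [Finite κ] [TopologicalSpace A]
    {f : X → κ → A} {a : A} {s : Set X} (hs : s ∈ comap f (𝓝 fun _ => a)) :
    ∃ N ∈ 𝓝 a, ∀ x, (∀ i, f x i ∈ N) → x ∈ s := by
  obtain ⟨M, hM, hMs⟩ := hs
  rw [nhds_pi, Filter.mem_pi'] at hM
  obtain ⟨I, u, hu, huM⟩ := hM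
  exact ⟨⋂ i, u i, Filter.iInter_mem.2 hu, fun x hx => hMs (huM fun i _ => Set.mem_iInter.1 (hx i) i)⟩

end Relative

/-! ### The closed loop expressed through the error systems -/

section Network

variable {E : Type*} [NormedAddCommGroup E] [NormedSpace ℝ E] [FiniteDimensional ℝ E]
variable {G : Type*} [TopologicalSpace G] [ChartedSpace E G] [Group G] [LieGroup 𝓘(ℝ, E) ∞ G]
variable {ι : Type*} [Fintype ι] {N : Network E G ι}

namespace Network

theorem sharp_pullLeft_differential (hN : N.Admissible) (i : ι) (h : G) :
    (N.inertia.sharp (pullLeft h (differential N.Ψ h)) : E) = (hN.errorSystem i).X h := by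
  have h1 : pullLeft (E := E) h (differential N.Ψ h) =
      ((leftDeriv E N.Ψ h).toLinearMap : E →ₗ[ℝ] ℝ) := by
    refine LinearMap.ext fun v => ?_
    exact pullLeft_differential (hN.errorFunction.smooth.mdifferentiable (by simp)) h v
  exact congrArg N.inertia.sharp h1

theorem sharp_positionError (hN : N.Admissible) (htree : IsOutTree N.graph none)
    (g : Option ι → G) (i : ι) :
    (N.inertia.sharp (N.positionError g i) : E) =
      (hN.errorSystem i).X ((g (htree.parent i))⁻¹ * g (some i)) := by
  have h1 : N.positionError g i =
      ((leftDeriv E N.Ψ ((g (htree.parent i))⁻¹ * g (some i))).toLinearMap : E →ₗ[ℝ] ℝ) := by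
    refine (htree.sum_adjCoeff_smul i (fun j => pullLeft (E := E) (g (some i))
      (differential (fun x => trackingError N.Ψ x (g j)) (g (some i))))).trans ?_
    refine LinearMap.ext fun v => ?_
    have hf : MDifferentiable 𝓘(ℝ, E) 𝓘(ℝ, ℝ)
        (fun x => trackingError N.Ψ x (g (htree.parent i))) :=
      (hN.errorFunction.smooth.mdifferentiable (by simp)).comp (mdifferentiable_mul_left _)
    refine (pullLeft_differential hf (g (some i)) v).trans ?_
    simp only [trackingError, ← mul_assoc]
    rfl
  exact congrArg N.inertia.sharp h1

theorem sigma_eq (hN : N.Admissible) (htree : IsOutTree N.graph none)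
    (g : Option ι → G) (w : Option ι → E) (i : ι) :
    (N.sigma g w i : E) = ((hN.errorSystem i).relative (g (htree.parent i), w (htree.parent i))
      (g (some i), w (some i))).2 := by
  let wi : Alg E G := w (some i)
  have h1 : (N.velocityError g w i : E) =
      w (some i) - adAct E ((g (some i))⁻¹ * g (htree.parent i)) (w (htree.parent i)) :=
    (htree.sum_adjCoeff_smul i (M := Alg E G)
      (fun j => wi - Ad ((g (some i))⁻¹ * g j) (w j))).trans
      (congrArg (fun x : E => w (some i) - x) (Ad_apply_eq _ _))
  have h2 : (g (some i))⁻¹ * g (htree.parent i) = ((g (htree.parent i))⁻¹ * g (some i))⁻¹ := by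
    group
  rw [h2] at h1
  exact congrArg₂ (fun x y : E => x + N.Kp • y) h1 (sharp_positionError hN htree g i)

/-- With in-degree 1 the two Coriolis terms cancel. What remains is the acceleration for which
`hasDerivWithinAt_iff_solvesWithinAt` yields the error system. -/
theorem acceleration_eq [CompleteSpace E] (hN : N.Admissible) (htree : IsOutTree N.graph none)
    (γ : Option ι → ℝ → G) (v : Option ι → ℝ → E) (i : ι) (t : ℝ) :
    ((N.inertia.sharp (adStar (v (some i) t : Alg E G) (N.inertia.flat (v (some i) t)))
      + N.inertia.sharp (N.control γ v i t) : Alg E G) : E) =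
    (hN.errorSystem i).acc ((hN.errorSystem i).relative
      (γ (htree.parent i) t, v (htree.parent i) t) (γ (some i) t, v (some i) t))
    + (coordBracket G (adAct E ((γ (htree.parent i) t)⁻¹ * γ (some i) t)⁻¹ (v (htree.parent i) t))
        (v (some i) t)
      + adAct E ((γ (htree.parent i) t)⁻¹ * γ (some i) t)⁻¹
        (derivWithin (v (htree.parent i)) (Ici 0) t))
    - (hN.errorSystem i).K •
      derivWithin (fun r => (hN.errorSystem i).X ((γ (htree.parent i) r)⁻¹ * γ (some i) r))
        (Ici 0) t := by
  let p := htree.parent i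
  let wi : Alg E G := v (some i) t
  let h := (γ p t)⁻¹ * γ (some i) t
  let J := N.inertia
  have h2 : (γ (some i) t)⁻¹ * γ p t = h⁻¹ := by simp only [h]; group
  have hc : N.control γ v i t =
      -((1 / N.α i) • (N.Kp • pullLeft h (differential N.Ψ h)
          + N.Rdiss (N.sigma (fun j => γ j t) (fun j => v j t) i)))
      + J.flat (⁅Ad (E := E) h⁻¹ (v p t), wi⁆ + Ad (E := E) h⁻¹ (derivWithin (v p) (Ici 0) t : E))
      - adStar wi (J.flat wi)
      - N.Kp • J.flat (derivWithin (fun s => J.sharp (N.positionError (fun j => γ j s) i))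
          (Ici 0) t) := by
    rw [← h2]
    simp only [control, htree.inDegree_eq_one, Nat.cast_one, div_one, one_smul]
    rw [htree.sum_adjCoeff_smul i (fun j => pullLeft ((γ j t)⁻¹ * γ (some i) t)
        (differential N.Ψ ((γ j t)⁻¹ * γ (some i) t))),
      htree.sum_adjCoeff_smul i (fun j => N.inertia.flat
        (⁅Ad (E := E) ((γ (some i) t)⁻¹ * γ j t) (v j t), wi⁆
        + Ad (E := E) ((γ (some i) t)⁻¹ * γ j t) (derivWithin (v j) (Ici 0) t)))]
    rfl
  have hs : J.sharp (adStar wi (J.flat wi)) + J.sharp (N.control γ v i t) =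
      -((1 / N.α i) • (N.Kp • J.sharp (pullLeft h (differential N.Ψ h))
          + J.sharp (N.Rdiss (N.sigma (fun j => γ j t) (fun j => v j t) i))))
      + (⁅Ad (E := E) h⁻¹ (v p t), wi⁆ + Ad (E := E) h⁻¹ (derivWithin (v p) (Ici 0) t : E))
      - N.Kp • (derivWithin (fun s => J.sharp (N.positionError (fun j => γ j s) i))
          (Ici 0) t) := by
    rw [hc]
    simp only [map_sub, map_add, map_neg, map_smul, J.sharp_flat]
    abel
  refine hs.trans ?_
  have e1 := sharp_pullLeft_differential hN i h
  have e2 := sigma_eq hN htree (fun j => γ j t) (fun j => v j t) i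
  have e3 : (⁅Ad (E := E) h⁻¹ (v p t), wi⁆ : Alg E G) =
      coordBracket G (adAct E h⁻¹ (v p t)) (v (some i) t) :=
    (bracket_eq _ _).trans
      (congrArg (fun x : E => coordBracket G x (v (some i) t)) (Ad_apply_eq _ _))
  have e4 := Ad_apply_eq (E := E) h⁻¹ (derivWithin (v p) (Ici 0) t)
  have e5 : (fun s => (J.sharp (N.positionError (fun j => γ j s) i) : E)) =
      fun r => (hN.errorSystem i).X ((γ p r)⁻¹ * γ (some i) r) :=
    funext fun s => sharp_positionError hN htree (fun j => γ j s) i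
  have e2' : (J.sharp (N.Rdiss (N.sigma (fun j => γ j t) (fun j => v j t) i)) : E) =
      (hN.errorSystem i).ρ ((hN.errorSystem i).relative (γ p t, v p t) (γ (some i) t, v (some i) t)).2 :=
    congrArg (hN.errorSystem i).ρ e2
  -- The pieces are joined by congruence because the equalities mix `Alg E G` and `E`, which agree
  -- only by unfolding.
  exact congrArg₂ (fun x y : E => x - N.Kp • y)
    (congrArg₂ (fun x y : E => x + y)
      (congrArg₂ (fun x y : E => -((1 / N.α i) • (N.Kp • x + y))) e1 e2')
      (congrArg₂ (fun x y : E => x + y) e3 e4))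
    (congrArg (fun f : ℝ → E => derivWithin f (Ici 0) t) e5)

end Network

end Network

/-! ### Trajectories, the set 𝒮³ and local asymptotic stability -/

section Network

variable {E : Type*} [NormedAddCommGroup E] [NormedSpace ℝ E] [FiniteDimensional ℝ E]
variable {G : Type*} [TopologicalSpace G] [ChartedSpace E G] [Group G] [LieGroup 𝓘(ℝ, E) ∞ G]
variable {ι : Type*} [Fintype ι] {N : Network E G ι}

namespace Network

/-- The state of agent `i` relative to its parent. -/
def relativeState (hN : N.Admissible) (htree : IsOutTree N.graph none) (z : Option ι → G × E)
    (i : ι) : G × E :=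
  (hN.errorSystem i).relative (z (htree.parent i)) (z (some i))

theorem tendsto_of_tendsto_relativeState (hN : N.Admissible) (htree : IsOutTree N.graph none)
    {α : Type*} {l : Filter α} {z : α → Option ι → G × E} {C : ℝ}
    (hC : ∀ᶠ a in l, ‖(z a none).2‖ ≤ C)
    (h : ∀ i, Tendsto (fun a => relativeState hN htree (z a) i) l (𝓝 (1, 0))) (j : Option ι) :
    Tendsto (fun a => ((z a none).1⁻¹ * (z a j).1, (z a j).2 - (z a none).2)) l (𝓝 (1, 0)) := by
  rw [nhds_prod_eq, tendsto_prod_iff']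
  refine htree.induction (P := fun j => Tendsto (fun a => (z a none).1⁻¹ * (z a j).1) l (𝓝 1) ∧
    Tendsto (fun a => (z a j).2 - (z a none).2) l (𝓝 0)) ?_ (fun i hi => ?_) j
  · simp only [inv_mul_cancel, sub_self]
    exact ⟨tendsto_const_nhds, tendsto_const_nhds⟩
  · exact (hN.errorSystem i).tendsto_of_tendsto_relative hC hi.1 hi.2 (h i)

theorem tendsto_relativeState (hN : N.Admissible) (htree : IsOutTree N.graph none)
    {α : Type*} {l : Filter α} {z : α → Option ι → G × E} {C : ℝ}
    (hC : ∀ᶠ a in l, ‖(z a none).2‖ ≤ C)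
    (h : ∀ i, Tendsto (fun a => ((z a none).1⁻¹ * (z a (some i)).1,
      (z a (some i)).2 - (z a none).2)) l (𝓝 (1, 0))) (i : ι) :
    Tendsto (fun a => relativeState hN htree (z a) i) l (𝓝 (1, 0)) := by
  have h' : ∀ j, Tendsto (fun a => (z a none).1⁻¹ * (z a j).1) l (𝓝 1) ∧
      Tendsto (fun a => (z a j).2 - (z a none).2) l (𝓝 0) := by
    rintro (_ | j)
    · simp only [inv_mul_cancel, sub_self]
      exact ⟨tendsto_const_nhds, tendsto_const_nhds⟩
    · have := h j
      rwa [nhds_prod_eq, tendsto_prod_iff'] at this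
  exact (hN.errorSystem i).tendsto_relative hC (h' _).1 (h' _).2 (h' _).1 (h' _).2

/-- Small relative states make all states close to that of the root. -/
theorem exists_nhds_relativeState (hN : N.Admissible) (htree : IsOutTree N.graph none) (C : ℝ)
    {M : Set (G × E)} (hM : M ∈ 𝓝 (1, 0)) :
    ∃ M' ∈ 𝓝 ((1, 0) : G × E), ∀ z : Option ι → G × E, ‖(z none).2‖ ≤ C →
      (∀ i, relativeState hN htree z i ∈ M') →
      ∀ j, ((z none).1⁻¹ * (z j).1, (z j).2 - (z none).2) ∈ M := by
  -- The filter pulled back along f is the coarsest one under which all relative states tend to (1,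
  -- 0). Only the bound C on the root velocity enters, so the neighbourhood obtained is uniform in
  -- time.
  let f : {z : Option ι → G × E // ‖(z none).2‖ ≤ C} → ι → G × E :=
    fun z i => relativeState hN htree z.1 i
  have h := tendsto_of_tendsto_relativeState hN htree (l := comap f (𝓝 fun _ => (1, 0)))
    (z := Subtype.val) (Eventually.of_forall fun z => z.2)
    (fun i => ((continuous_apply i).tendsto fun _ => ((1, 0) : G × E)).comp
      (tendsto_comap (f := f)))
  obtain ⟨M', hM', hf⟩ := exists_mem_nhds_of_mem_comap
    (eventually_all.2 fun j => h j hM : ∀ᶠ z in comap f (𝓝 fun _ => (1, 0)), ∀ j,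
      ((z.1 none).1⁻¹ * (z.1 j).1, (z.1 j).2 - (z.1 none).2) ∈ M)
  exact ⟨M', hM', fun z hz hr => hf ⟨z, hz⟩ hr⟩

/-- Closeness of all states to that of the root makes the relative states small. -/
theorem exists_nhds_states (hN : N.Admissible) (htree : IsOutTree N.graph none) (C : ℝ)
    {M : ι → Set (G × E)} (hM : ∀ i, M i ∈ 𝓝 (1, 0)) :
    ∃ M' ∈ 𝓝 ((1, 0) : G × E), ∀ z : Option ι → G × E, ‖(z none).2‖ ≤ C →
      (∀ i, ((z none).1⁻¹ * (z (some i)).1, (z (some i)).2 - (z none).2) ∈ M') →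
      ∀ i, relativeState hN htree z i ∈ M i := by
  let f : {z : Option ι → G × E // ‖(z none).2‖ ≤ C} → ι → G × E :=
    fun z i => ((z.1 none).1⁻¹ * (z.1 (some i)).1, (z.1 (some i)).2 - (z.1 none).2)
  have h := tendsto_relativeState hN htree (l := comap f (𝓝 fun _ => (1, 0)))
    (z := Subtype.val) (Eventually.of_forall fun z => z.2)
    (fun i => ((continuous_apply i).tendsto fun _ => ((1, 0) : G × E)).comp
      (tendsto_comap (f := f)))
  obtain ⟨M', hM', hf⟩ := exists_mem_nhds_of_mem_comap
    (eventually_all.2 fun i => h i (hM i) : ∀ᶠ z in comap f (𝓝 fun _ => (1, 0)), ∀ i,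
      relativeState hN htree z.1 i ∈ M i)
  exact ⟨M', hM', fun z hz hr => hf ⟨z, hz⟩ hr⟩

/-- The states at time `t` of the reference and of the agents. -/
def state (γr : ℝ → G) (vr : ℝ → E) (γ : ι → ℝ → G) (v : ι → ℝ → E) (t : ℝ) (j : Option ι) :
    G × E :=
  (withRef γr γ j t, withRef vr v j t)

variable [CompleteSpace E] {γr : ℝ → G} {vr : ℝ → E}

theorem hasBodyVelocityWithinAt {γ : ℝ → G} {v : ℝ → E} (h : HasBodyVelocity γ v) {t : ℝ}
    (ht : 0 ≤ t) : HasBodyVelocityWithinAt γ (v t) (Ici 0) t :=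
  hasMFDerivWithinAt_iff_hasBodyVelocityWithinAt.1 (h t ht)

theorem IsTrajectory.solvesWithinAt (hN : N.Admissible) (htree : IsOutTree N.graph none)
    (hγr : HasBodyVelocity γr vr) (hvr : DifferentiableOn ℝ vr (Ici 0))
    {γ : ι → ℝ → G} {v : ι → ℝ → E} (h : N.IsTrajectory γr vr γ v) (i : ι) (t : ℝ) (ht : 0 ≤ t) :
    (hN.errorSystem i).SolvesWithinAt (fun r => relativeState hN htree (state γr vr γ v r) i)
      (Ici 0) t := by
  have hbody : ∀ j, HasBodyVelocityWithinAt (withRef γr γ j) (withRef vr v j t) (Ici 0) t := by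
    rintro (_ | j)
    · exact hasBodyVelocityWithinAt hγr ht
    · exact hasBodyVelocityWithinAt (h.kinematics j) ht
  have hdiff : ∀ j, DifferentiableWithinAt ℝ (withRef vr v j) (Ici 0) t := by
    rintro (_ | j)
    · exact hvr t ht
    · exact HasDerivWithinAt.differentiableWithinAt (F := E) (h.dynamics j t ht)
  refine ((hN.errorSystem i).hasDerivWithinAt_iff_solvesWithinAt (uniqueDiffOn_Ici 0 t ht)
    (hbody (htree.parent i)) (hbody (some i)) (hdiff _)).1 ?_
  exact HasDerivWithinAt.congr_deriv (F := E) (h.dynamics i t ht)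
    (acceleration_eq hN htree (withRef γr γ) (withRef vr v) i t)

/-- The error systems do not involve each other, so they are solved separately. The agents are then
recovered from the root outwards by γ_i = γ_p h_i and v_i = σ_i + Ad_{h_i⁻¹} v_p - K_p X(h_i). -/
theorem exists_trajectory (hN : N.Admissible) (htree : IsOutTree N.graph none)
    (hγr : HasBodyVelocity γr vr) (hvr : DifferentiableOn ℝ vr (Ici 0)) (g : ι → G) (w : ι → E) :
    ∃ γ v, N.IsTrajectory γr vr γ v ∧ (∀ i, γ i 0 = g i) ∧ ∀ i, v i 0 = w i := by
  let z₀ : Option ι → G × E := fun j => (withRef (γr 0) g j, withRef (vr 0) w j)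
  choose x hx0 hx using fun i => (hN.errorSystem i).exists_solution (relativeState hN htree z₀ i)
  obtain ⟨f, hf0, hf⟩ := htree.exists_rec ((γr, vr) : (ℝ → G) × (ℝ → E))
    fun i p => (fun t => p.1 t * (x i t).1, fun t => (x i t).2 +
      (adAct E (x i t).1⁻¹ (p.2 t) - (hN.errorSystem i).K • (hN.errorSystem i).X (x i t).1))
  have hf1 : ∀ i t, (f (some i)).1 t = (f (htree.parent i)).1 t * (x i t).1 := by
    intro i t; rw [hf]
  have hf2 : ∀ i t, (f (some i)).2 t = (x i t).2 + (adAct E (x i t).1⁻¹ ((f (htree.parent i)).2 t) -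
      (hN.errorSystem i).K • (hN.errorSystem i).X (x i t).1) := by
    intro i t; rw [hf]
  have hrel : ∀ i, (fun r => (hN.errorSystem i).relative
      ((f (htree.parent i)).1 r, (f (htree.parent i)).2 r)
      ((f (some i)).1 r, (f (some i)).2 r)) = x i := by
    intro i
    funext r
    have h1 : ((f (htree.parent i)).1 r)⁻¹ * (f (some i)).1 r = (x i r).1 := by
      rw [hf1, inv_mul_cancel_left]
    refine Prod.ext h1 ?_
    simp only [ErrorSystem.relative, h1, hf2]
    abel
  -- Both properties travel along the tree together: differentiability of the parent's velocity is
  -- needed for that of the child.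
  have hreg : ∀ t, 0 ≤ t → ∀ j, HasBodyVelocityWithinAt (f j).1 ((f j).2 t) (Ici 0) t ∧
      DifferentiableWithinAt ℝ (f j).2 (Ici 0) t := by
    intro t ht
    refine htree.induction ?_ fun i hi => ?_
    · rw [hf0]
      exact ⟨hasBodyVelocityWithinAt hγr ht, hvr t ht⟩
    · have h1 := (hx i t ht).1
      have h2 := hi.1.mul h1
      have h3 := ((hx i t ht).2.add ((h1.hasDerivWithinAt_adAct_inv hi.2.hasDerivWithinAt).sub
        ((h1.hasDerivWithinAt_comp (hN.errorSystem i).smooth_grad).const_smul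
          (hN.errorSystem i).K))).differentiableWithinAt
      have e1 : (f (some i)).2 t = adAct E (x i t).1⁻¹ ((f (htree.parent i)).2 t) +
          (hN.errorSystem i).vel (x i t) := by
        rw [hf2, ErrorSystem.vel]
        abel
      rw [e1, hf]
      exact ⟨h2, h3⟩
  have hinit : ∀ j, ((f j).1 0, (f j).2 0) = z₀ j := by
    refine htree.induction ?_ fun i hi => ?_
    · rw [hf0]
      rfl
    · have h1 : (f (htree.parent i)).1 0 = (z₀ (htree.parent i)).1 := congrArg Prod.fst hi
      have h2 : (f (htree.parent i)).2 0 = (z₀ (htree.parent i)).2 := congrArg Prod.snd hi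
      rw [hf1, hf2, h1, h2, hx0]
      simp only [relativeState, ErrorSystem.relative]
      refine Prod.ext (mul_inv_cancel_left _ _) ?_
      simp only
      abel
  have hγ : withRef γr (fun i => (f (some i)).1) = fun j => (f j).1 := by
    funext j
    rcases j with _ | j
    · rw [hf0]; rfl
    · rfl
  have hv : withRef vr (fun i => (f (some i)).2) = fun j => (f j).2 := by
    funext j
    rcases j with _ | j
    · rw [hf0]; rfl
    · rfl
  refine ⟨fun i => (f (some i)).1, fun i => (f (some i)).2, ⟨fun i t ht => ?_, fun i t ht => ?_⟩,
    fun i => congrArg Prod.fst (hinit (some i)), fun i => congrArg Prod.snd (hinit (some i))⟩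
  · exact hasMFDerivWithinAt_iff_hasBodyVelocityWithinAt.2 (hreg t ht (some i)).1
  · have h1 := hx i t ht
    rw [← hrel i] at h1
    have h2 := ((hN.errorSystem i).hasDerivWithinAt_iff_solvesWithinAt (uniqueDiffOn_Ici 0 t ht)
      (hreg t ht (htree.parent i)).1 (hreg t ht (some i)).1 (hreg t ht _).2).2 h1
    refine HasDerivWithinAt.congr_deriv (F := E) h2 ?_
    have h3 := acceleration_eq hN htree (fun j => (f j).1) (fun j => (f j).2) i t
    exact h3.symm.trans (congrArg₂ (fun (a : Option ι → ℝ → G) (b : Option ι → ℝ → Alg E G) =>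
      N.inertia.sharp (adStar ((f (some i)).2 t : Alg E G) (N.inertia.flat ((f (some i)).2 t)))
        + N.inertia.sharp (N.control a b i t)) hγ.symm hv.symm)

theorem exists_norm_le_of_form_le (J : Inertia E G) (h : ∃ C : ℝ, ∀ t, 0 ≤ t → J.form (vr t) (vr t) ≤ C) :
    ∃ C : ℝ, ∀ t, 0 ≤ t → ‖vr t‖ ≤ C := by
  obtain ⟨C, hC⟩ := h
  obtain ⟨c, hc, hcJ⟩ := exists_coercive_of_pos J.formCLM fun v hv => J.pos v hv
  refine ⟨√(C / c), fun t ht => Real.le_sqrt_of_sq_le ?_⟩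
  rw [le_div_iff₀ hc, mul_comm]
  exact (hcJ (vr t)).trans (hC t ht)

/-- The condition defining 𝒮³ is V < K_p τ_L on the edge into i. If no level L ≥ V / K_p had e as
its only critical point, every level in the supremum would be at most V / K_p, and so would τ_L. -/
theorem exists_level (hN : N.Admissible) (htree : IsOutTree N.graph none) {g : Option ι → G}
    {w : Option ι → E} (h : (g, w) ∈ N.initialSet E) (i : ι) :
    ∃ L : ℝ, (hN.errorSystem i).energy (relativeState hN htree (fun j => (g j, w j)) i) ≤
      (hN.errorSystem i).K * L ∧
      ∀ a, (hN.errorSystem i).Ψ a ≤ L → (hN.errorSystem i).X a = 0 → a = 1 := by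
  have h1 := h i (htree.parent i) ((htree.adj_iff i _).2 rfl)
  set e := (hN.errorSystem i).energy (relativeState hN htree (fun j => (g j, w j)) i) with he
  have h2 : (N.Kp * adjCoeff N.graph (some i) (htree.parent i) *
      trackingError N.Ψ (g (some i)) (g (htree.parent i))
      + (1 / 2) * N.α i * N.inertia.form (N.sigma g w i) (N.sigma g w i) : ℝ) = e := by
    rw [htree.adjCoeff_parent, mul_one, he]
    have h3 := congrArg (fun y : E => N.inertia.formCLM y y) (sigma_eq hN htree g w i)
    refine congrArg (fun y : ℝ => N.Kp * N.Ψ ((g (htree.parent i))⁻¹ * g (some i)) + y) ?_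
    rw [one_div_mul_eq_div]
    exact congrArg (fun y : ℝ => N.α i / 2 * y) h3
  simp only at h1
  rw [h2] at h1
  by_contra! hcon
  refine h1.not_ge ?_
  have hle : criticalLevel E N.Ψ ≤ ((e / N.Kp : ℝ) : EReal) := by
    refine sSup_le ?_
    rintro _ ⟨L, rfl, -, hL⟩
    rw [EReal.coe_le_coe_iff]
    by_contra! hlt
    rw [div_lt_iff₀' hN.Kp_pos] at hlt
    obtain ⟨a, ha, hXa, hne⟩ := hcon L hlt.le
    refine hL a ⟨ha, hne⟩ (differential_eq_zero
      (hN.errorFunction.smooth.mdifferentiable (by simp)) a ?_)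
    ext v
    rw [← N.inertia.formCLM_sharpCLM (leftDeriv E N.Ψ a) v]
    have hXa' : N.inertia.sharpCLM (leftDeriv E N.Ψ a) = 0 := hXa
    rw [hXa', map_zero]
  refine (mul_le_mul_of_nonneg_left hle (EReal.coe_nonneg.2 hN.Kp_pos.le)).trans ?_
  rw [← EReal.coe_mul, mul_div_cancel₀ _ hN.Kp_pos.ne']

theorem tracks_of_tendsto (hN : N.Admissible) (htree : IsOutTree N.graph none)
    {C : ℝ} (hC : ∀ t, 0 ≤ t → ‖vr t‖ ≤ C) {γ : ι → ℝ → G} {v : ι → ℝ → E}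
    (h : ∀ i, Tendsto (fun r => relativeState hN htree (state γr vr γ v r) i) atTop (𝓝 (1, 0))) :
    Tracks (E := E) γr vr γ v := by
  intro i
  have h1 := tendsto_of_tendsto_relativeState hN htree (z := state γr vr γ v)
    ((eventually_ge_atTop 0).mono hC) h (some i)
  rw [nhds_prod_eq, tendsto_prod_iff'] at h1
  exact h1

theorem trackingIsLAS [T2Space G] (hN : N.Admissible) (htree : IsOutTree N.graph none)
    (hγr : HasBodyVelocity γr vr) (hvr : DifferentiableOn ℝ vr (Ici 0))
    {C : ℝ} (hC : ∀ t, 0 ≤ t → ‖vr t‖ ≤ C) : N.TrackingIsLAS γr vr := by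
  constructor
  · intro U hU W hW
    -- Neighbourhoods are chosen backwards: from U, W to small relative states at time t, through
    -- trapping to relative states at time 0, and from there to initial states of the agents.
    obtain ⟨M, hM, hMUW⟩ := exists_nhds_relativeState hN htree C
      (prod_mem_nhds hU (hW : (W : Set E) ∈ 𝓝 (0 : E)))
    obtain ⟨U', hU', W', hW', hUW⟩ := mem_nhds_prod_iff.1 hM
    choose M₁ hM₁ htrap using fun i => (hN.errorSystem i).exists_trapping hU' hW'
    obtain ⟨M₂, hM₂, hrel⟩ := exists_nhds_states hN htree C hM₁
    obtain ⟨U₀, hU₀, W₀, hW₀, hUW₀⟩ := mem_nhds_prod_iff.1 hM₂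
    refine ⟨U₀, hU₀, W₀, hW₀, fun γ v hγv hnear t ht i => ?_⟩
    have h1 := hrel (state γr vr γ v 0) (hC 0 le_rfl) fun i => hUW₀ ⟨(hnear i).1, (hnear i).2⟩
    have h2 := hMUW (state γr vr γ v t) (hC t ht)
      (fun i => hUW (htrap i _ (hγv.solvesWithinAt hN htree hγr hvr i) (h1 i) t ht)) (some i)
    exact h2
  · choose M₁ hM₁ hbasin using fun i => (hN.errorSystem i).exists_basin
    obtain ⟨M₂, hM₂, hrel⟩ := exists_nhds_states hN htree C hM₁
    obtain ⟨U₁, hU₁, W₁, hW₁, hUW₁⟩ := mem_nhds_prod_iff.1 hM₂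
    refine ⟨U₁, hU₁, W₁, hW₁, fun g w _ => exists_trajectory hN htree hγr hvr g w,
      fun γ v hγv hnear => ?_⟩
    have h1 := hrel (state γr vr γ v 0) (hC 0 le_rfl) fun i => hUW₁ ⟨(hnear i).1, (hnear i).2⟩
    exact tracks_of_tendsto hN htree hC fun i =>
      hbasin i _ (hγv.solvesWithinAt hN htree hγr hvr i) (h1 i)

theorem tracks_of_mem_initialSet [T2Space G] (hN : N.Admissible) (htree : IsOutTree N.graph none)
    (hγr : HasBodyVelocity γr vr) (hvr : DifferentiableOn ℝ vr (Ici 0))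
    {C : ℝ} (hC : ∀ t, 0 ≤ t → ‖vr t‖ ≤ C) {γ : ι → ℝ → G} {v : ι → ℝ → E}
    (h : N.IsTrajectory γr vr γ v)
    (h0 : (withRef (γr 0) fun i => γ i 0, withRef (vr 0) fun i => v i 0) ∈ N.initialSet E) :
    Tracks (E := E) γr vr γ v := by
  refine tracks_of_tendsto hN htree hC fun i => ?_
  obtain ⟨L, hL, hcrit⟩ := exists_level hN htree h0 i
  refine (hN.errorSystem i).tendsto_of_energy_lt (h.solvesWithinAt hN htree hγr hvr i) ?_ hcrit
  have h1 : state γr vr γ v 0 = fun j => (withRef (γr 0) (fun i => γ i 0) j,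
      withRef (vr 0) (fun i => v i 0) j) := by
    funext j
    rcases j with _ | j <;> rfl
  rw [h1]
  exact hL

end Network

end Network

end LieConsensus

end

theorem theorem3
    {E : Type*} [NormedAddCommGroup E] [NormedSpace ℝ E] [FiniteDimensional ℝ E] [CompleteSpace E]
    {G : Type*} [TopologicalSpace G] [T2Space G] [ChartedSpace E G] [Group G]
    [LieGroup 𝓘(ℝ, E) ∞ G]
    {ι : Type*} [Fintype ι]
    (N : LieConsensus.Network E G ι) (hN : N.Admissible)
    (htree : LieConsensus.IsOutTree N.graph none)
    (γr : ℝ → G) (vr : ℝ → LieConsensus.Alg E G)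
    (hγr : LieConsensus.HasBodyVelocity γr vr)
    (hvr : DifferentiableOn ℝ vr (Set.Ici 0))
    (hbdd : ∃ C : ℝ, ∀ t, 0 ≤ t → N.inertia.form (vr t) (vr t) ≤ C) :
    (∀ (g : ι → G) (w : ι → LieConsensus.Alg E G),
      (LieConsensus.withRef (γr 0) g, LieConsensus.withRef (vr 0) w) ∈ N.initialSet E →
        (∃ γ v, N.IsTrajectory γr vr γ v ∧ (∀ i, γ i 0 = g i) ∧ (∀ i, v i 0 = w i)) ∧
        ∀ γ v, N.IsTrajectory γr vr γ v → (∀ i, γ i 0 = g i) → (∀ i, v i 0 = w i) →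
          LieConsensus.Network.Tracks γr vr γ v) ∧
    N.TrackingIsLAS γr vr := by
  obtain ⟨C, hC⟩ := LieConsensus.Network.exists_norm_le_of_form_le N.inertia hbdd
  refine ⟨fun g w hgw => ⟨LieConsensus.Network.exists_trajectory hN htree hγr hvr g w,
    fun γ v hγv hg hw => ?_⟩, LieConsensus.Network.trackingIsLAS hN htree hγr hvr hC⟩
  obtain rfl : (fun i => γ i 0) = g := funext hg
  obtain rfl : (fun i => v i 0) = w := funext hw
  exact LieConsensus.Network.tracks_of_mem_initialSet hN htree hγr hvr hC hγv hgw
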